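/- All graphs are finite and simple. A graph is $2$-connected if it has at least three vertices, is connected, and remains connected after deleting any single vertex. A graph $H$ is an HC-obstruction if $H$ is $2$-connected, has no Hamiltonian cycle, and every induced subgraph of $H$ either equals $H$, or is not $2$-connected, or has a Hamiltonian cycle. A theta with ends $u,v$ is a graph consisting of two distinct non-adjacent vertices $u$ and $v$ and three paths $P_1,P_2,P_3$ from $u$ to $v$, each of length at least two, such that the sets $V(P_i)\setminus\{u,v\}$, $i=1,2,3$, are pairwise disjoint and have no edges between them (so the vertex set and the edge set of the theta are exactly the unions of those of $P_1,P_2,P_3$). A closed theta is a graph obtained from a theta with ends $u,v$ by adding the edge $uv$. A wheel is a graph consisting of a chordless cycle $W$ and one further vertex $v\notin V(W)$ that has at least three neighbours in $W$. A graph is triangle-free if it contains no three pairwise adjacent vertices. **Theorem.** All thetas, all triangle-free closed thetas and all triangle-free wheels are HC-obstructions, and they are the only triangle-free HC-obstructions. That is, a graph $G$ is a triangle-free HC-obstruction if and only if $G$ is a theta, a triangle-free closed theta, or a triangle-free wheel. -/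

import Mathlib

namespace SimpleGraph

variable {V : Type*}

/-- A graph (on finitely many vertices) is 2-connected if it has at least three vertices, is
connected, and stays connected after the deletion of any one vertex. -/
def IsTwoConnected (G : SimpleGraph V) : Prop :=
  3 ≤ Nat.card V ∧ G.Connected ∧ ∀ v : V, (G.induce {v}ᶜ).Connected

open Classical in
/-- `G` has a Hamiltonian cycle. (Unlike `SimpleGraph.IsHamiltonian`, the one-vertex graph is not
given a special treatment.) -/
def HasHamiltonianCycle (G : SimpleGraph V) : Prop :=
  ∃ (a : V) (p : G.Walk a a), p.IsHamiltonianCycle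

/-- An HC-obstruction: a 2-connected graph without a Hamiltonian cycle, each of whose induced
subgraphs is the whole graph, or not 2-connected, or has a Hamiltonian cycle. -/
def IsHCObstruction (G : SimpleGraph V) : Prop :=
  G.IsTwoConnected ∧ ¬ G.HasHamiltonianCycle ∧
    ∀ S : Set V, S = Set.univ ∨ ¬ (G.induce S).IsTwoConnected ∨ (G.induce S).HasHamiltonianCycle

/-- `G` is a theta with ends `u` and `v`: the vertices `u`, `v` are distinct and non-adjacent, and
`G` is the union of three paths from `u` to `v`, each of length at least two, whose interiors are
pairwise disjoint. Every edge of `G` is an edge of one of the paths; in particular there are no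
edges between the interiors of different paths. -/
def IsThetaWithEnds (G : SimpleGraph V) (u v : V) : Prop :=
  u ≠ v ∧ ¬ G.Adj u v ∧ ∃ P : Fin 3 → G.Walk u v,
    (∀ i, (P i).IsPath ∧ 2 ≤ (P i).length) ∧
    (∀ i j, i ≠ j → ∀ x, x ∈ (P i).support → x ∈ (P j).support → x = u ∨ x = v) ∧
    (∀ x, ∃ i, x ∈ (P i).support) ∧
    (∀ x y, G.Adj x y → ∃ i, s(x, y) ∈ (P i).edges)

/-- `G` is a theta. -/
def IsTheta (G : SimpleGraph V) : Prop :=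
  ∃ u v : V, G.IsThetaWithEnds u v

/-- `G` is a closed theta: it is obtained from a theta with ends `u`, `v` by adding the
edge `uv`. -/
def IsClosedTheta (G : SimpleGraph V) : Prop :=
  ∃ (H : SimpleGraph V) (u v : V), H.IsThetaWithEnds u v ∧ G = H ⊔ edge u v

/-- `G` is a wheel: it consists of a cycle `c` and a further vertex `v` that has at least three
neighbours on `c`. Every edge of `G` not incident with `v` is an edge of `c`, i.e. the cycle has
no chords. -/
def IsWheel (G : SimpleGraph V) : Prop :=
  ∃ (v a : V) (c : G.Walk a a), c.IsCycle ∧ v ∉ c.support ∧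
    (∀ x, x ≠ v → x ∈ c.support) ∧
    (∀ x y, x ≠ v → y ≠ v → G.Adj x y → s(x, y) ∈ c.edges) ∧
    3 ≤ {x | x ∈ c.support ∧ G.Adj v x}.ncard

end SimpleGraph

namespace SimpleGraph

variable {V : Type*} {G : SimpleGraph V} {S T : Set V} {x y z u v w : V}

/-! ### Connectivity and Hamiltonicity relative to a set of vertices -/

/-! Why the three families are obstructions. In a theta or closed theta, a Hamiltonian cycle splits
at the ends `u`, `v` into two arcs. The interior of an arc is connected, so it meets the interior of
at most one of the three paths, and two arcs cannot cover three interiors. In a triangle-free wheel,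
a Hamiltonian cycle without the hub is a Hamiltonian path of the rim whose ends are non-adjacent;
its interior is connected, yet deleting two non-adjacent vertices disconnects the rim. Since
2-connectedness forces degree at least two, the proper 2-connected induced subgraphs are cycles, or
in the closed theta cycles through both ends with at most the chord `uv`; all are Hamiltonian.

The converse rests on `TwoConnectedOn.exists_cycle`: a 2-connected triangle-free graph without
induced theta, closed theta or wheel is Hamiltonian. Take a chordless cycle `c`. If it misses a
vertex, consider a component outside `c`. Two non-adjacent attachments of it on `c` would yield a
theta or a wheel (`hasThreePathOrWheelIn_of_attachments`), so the attachments are pairwise adjacent,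
and by triangle-freeness there are only two. Their edge `xy` is then a cutset. It leaves exactly two
components, as three would give a closed theta. Induction applies to each component together with
`x` and `y`, and the two cycles are glued along `xy`. For this they must use `xy`, so the induction
proves more: the cycle contains every edge whose ends do not separate the graph.

A theta, closed theta or wheel found inside an obstruction is the whole obstruction, by minimality.
All of this is done with vertex sets `S` in one fixed graph, so that induction never changes the
vertex type. -/

/-- There is a walk from `x` to `y` all of whose vertices lie in `S`. -/
def ReachableIn (G : SimpleGraph V) (S : Set V) (x y : V) : Prop :=
  ∃ p : G.Walk x y, ∀ z ∈ p.support, z ∈ S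

/-- The subgraph induced on `S` is 2-connected. -/
def TwoConnectedOn (G : SimpleGraph V) (S : Set V) : Prop :=
  3 ≤ S.ncard ∧ ∀ v, ∀ x ∈ S, ∀ y ∈ S, x ≠ v → y ≠ v → G.ReachableIn (S \ {v}) x y

/-- The subgraph induced on `S` has a Hamiltonian cycle. -/
def HamiltonianOn (G : SimpleGraph V) (S : Set V) : Prop :=
  ∃ (a : V) (c : G.Walk a a), c.IsCycle ∧ ∀ x, x ∈ c.support ↔ x ∈ S

namespace ReachableIn

theorem refl (hx : x ∈ S) : G.ReachableIn S x x :=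
  ⟨.nil, by simpa using hx⟩

theorem symm (h : G.ReachableIn S x y) : G.ReachableIn S y x := by
  obtain ⟨p, hp⟩ := h
  exact ⟨p.reverse, by simpa using hp⟩

theorem trans (h : G.ReachableIn S x y) (h' : G.ReachableIn S y z) : G.ReachableIn S x z := by
  obtain ⟨p, hp⟩ := h
  obtain ⟨q, hq⟩ := h'
  refine ⟨p.append q, fun w hw => ?_⟩
  rcases (Walk.mem_support_append_iff p q).1 hw with hw | hw
  exacts [hp w hw, hq w hw]

theorem mono (h : G.ReachableIn S x y) (hST : S ⊆ T) : G.ReachableIn T x y := by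
  obtain ⟨p, hp⟩ := h
  exact ⟨p, fun w hw => hST (hp w hw)⟩

theorem left_mem (h : G.ReachableIn S x y) : x ∈ S := by
  obtain ⟨p, hp⟩ := h
  exact hp _ p.start_mem_support

theorem right_mem (h : G.ReachableIn S x y) : y ∈ S := h.symm.left_mem

theorem of_adj (hx : x ∈ S) (hy : y ∈ S) (h : G.Adj x y) : G.ReachableIn S x y :=
  ⟨h.toWalk, by simp [hx, hy]⟩

/-- A walk that leaves a set does so along an edge. -/
theorem exists_adj_boundary (h : G.ReachableIn S x y) {K : Set V} (hx : x ∈ K) (hy : y ∉ K) :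
    ∃ a ∈ S, ∃ b ∈ S, a ∈ K ∧ b ∉ K ∧ G.Adj a b := by
  obtain ⟨p, hp⟩ := h
  obtain ⟨d, hd, h1, h2⟩ := p.exists_boundary_dart K hx hy
  exact ⟨d.fst, hp _ (p.dart_fst_mem_support_of_mem_darts hd), d.snd,
    hp _ (p.dart_snd_mem_support_of_mem_darts hd), h1, h2, d.adj⟩

theorem mem_of_closed (h : G.ReachableIn S x y) {K : Set V} (hx : x ∈ K)
    (hK : ∀ a ∈ K, ∀ b ∈ S, G.Adj a b → b ∈ K) : y ∈ K := by
  by_contra hy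
  obtain ⟨a, -, b, hb, ha, hbK, hab⟩ := h.exists_adj_boundary hx hy
  exact hbK (hK a ha b hb hab)

end ReachableIn

theorem reachableIn_induce_iff {A : Set S} {x y : S} :
    (G.induce S).ReachableIn A x y ↔ G.ReachableIn (Subtype.val '' A) x y := by
  constructor
  · rintro ⟨p, hp⟩
    refine ⟨p.map (Embedding.induce S).toHom, fun z hz => ?_⟩
    obtain ⟨w, hw, rfl⟩ := List.mem_map.1 ((Walk.support_map _ p) ▸ hz)
    exact ⟨w, hp w hw, rfl⟩
  · rintro ⟨p, hp⟩
    have hS : ∀ z ∈ p.support, z ∈ S := by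
      intro z hz
      obtain ⟨w, -, rfl⟩ := hp z hz
      exact w.2
    refine ⟨p.induce S hS, fun z hz => ?_⟩
    rw [Walk.support_induce, List.mem_attachWith] at hz
    obtain ⟨w, hw, h⟩ := hp z hz
    rwa [← Subtype.ext h]

theorem preconnected_induce_iff_reachableIn :
    (G.induce S).Preconnected ↔ ∀ x ∈ S, ∀ y ∈ S, G.ReachableIn S x y := by
  have key : ∀ x y : S, (G.induce S).Reachable x y ↔ G.ReachableIn S x y := by
    intro x y
    have := @reachableIn_induce_iff V G S Set.univ x y
    rw [Set.image_univ, Subtype.range_coe] at this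
    rw [← this]
    exact ⟨fun ⟨p⟩ => ⟨p, fun _ _ => trivial⟩, fun ⟨p, _⟩ => ⟨p⟩⟩
  exact ⟨fun h x hx y hy => (key ⟨x, hx⟩ ⟨y, hy⟩).1 (h _ _),
    fun h x y => (key x y).2 (h x x.2 y y.2)⟩

theorem isTwoConnected_iff : G.IsTwoConnected ↔ 3 ≤ Nat.card V ∧
    ∀ v x y : V, x ≠ v → y ≠ v → G.ReachableIn {v}ᶜ x y := by
  constructor
  · rintro ⟨h3, -, h⟩
    exact ⟨h3, fun v x y hx hy => preconnected_induce_iff_reachableIn.1 (h v).preconnected x hx y hy⟩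
  · rintro ⟨h3, h⟩
    -- Two vertices are joined already in the graph minus a third one, so connectedness of the whole
    -- graph need not be assumed.
    have third : ∀ x y : V, ∃ v, v ≠ x ∧ v ≠ y := by
      intro x y
      have hf : Finite V := Nat.finite_of_card_ne_zero (by omega)
      by_contra! hc
      have : (Set.univ : Set V) ⊆ {x, y} := by
        intro v _
        by_cases hv : v = x
        · simp [hv]
        · simp [hc v hv]
      have h1 := Set.ncard_le_ncard this (Set.toFinite _)
      have h2 := Set.ncard_insert_le x {y}
      rw [Set.ncard_univ] at h1
      rw [Set.ncard_singleton] at h2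
      omega
    have hne : Nonempty V := (Nat.card_pos_iff.1 (by omega)).1
    refine ⟨h3, ⟨fun x y => ?_⟩, fun v => ?_⟩
    · obtain ⟨v, hvx, hvy⟩ := third x y
      obtain ⟨p, -⟩ := h v x y hvx.symm hvy.symm
      exact ⟨p⟩
    · obtain ⟨w, hw, -⟩ := third v v
      have : Nonempty ({v}ᶜ : Set V) := ⟨⟨w, hw⟩⟩
      exact ⟨preconnected_induce_iff_reachableIn.2 fun x hx y hy => h v x y hx hy⟩

theorem isTwoConnected_iff_univ : G.IsTwoConnected ↔ G.TwoConnectedOn Set.univ := by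
  rw [isTwoConnected_iff, TwoConnectedOn, Set.ncard_univ]
  simp [Set.compl_eq_univ_sdiff]

theorem isTwoConnected_induce_iff : (G.induce S).IsTwoConnected ↔ G.TwoConnectedOn S := by
  rw [isTwoConnected_iff, TwoConnectedOn, ← Nat.card_coe_set_eq]
  refine and_congr_right fun h3 => ?_
  have im : ∀ v : S, (Subtype.val '' ({v}ᶜ : Set S)) = S \ {v.1} := by
    intro v
    ext w
    simp [and_comm]
  constructor
  · intro h v x hx y hy hxv hyv
    by_cases hv : v ∈ S
    · have := reachableIn_induce_iff.1 (h ⟨v, hv⟩ ⟨x, hx⟩ ⟨y, hy⟩ (by simpa) (by simpa))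
      rwa [im] at this
    -- Deleting a vertex outside `S` changes nothing; this case is the connectedness of `S` itself.
    · have hc := (isTwoConnected_iff.2 ⟨h3, h⟩).2.1
      rw [Set.sdiff_singleton_eq_self hv]
      exact preconnected_induce_iff_reachableIn.1 hc.preconnected x hx y hy
  · intro h v x y hx hy
    rw [reachableIn_induce_iff, im]
    exact h v x x.2 y y.2 (fun e => hx (Subtype.ext e)) fun e => hy (Subtype.ext e)

theorem hasHamiltonianCycle_iff : G.HasHamiltonianCycle ↔ G.HamiltonianOn Set.univ := by
  classical
  constructor
  · rintro ⟨a, c, hc⟩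
    refine ⟨a, c, hc.isCycle, fun x => ⟨fun _ => trivial, fun _ => ?_⟩⟩
    exact Walk.IsHamiltonianCycle.mem_support hc x
  · rintro ⟨a, c, hc, hs⟩
    refine ⟨a, c, hc, hc.isPath_tail.isHamiltonian_of_mem fun w => ?_⟩
    rw [Walk.support_tail_of_not_nil _ hc.not_nil]
    have hw := (hs w).2 trivial
    rw [← Walk.cons_tail_support, List.mem_cons] at hw
    rcases hw with rfl | hw
    · exact Walk.end_mem_tail_support hc.not_nil
    · exact hw

theorem hasHamiltonianCycle_induce_iff :
    (G.induce S).HasHamiltonianCycle ↔ G.HamiltonianOn S := by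
  rw [hasHamiltonianCycle_iff]
  constructor
  · rintro ⟨a, c, hc, hs⟩
    refine ⟨a, c.map (Embedding.induce S).toHom, hc.map Subtype.val_injective, fun x => ?_⟩
    refine Iff.trans (b := x ∈ c.support.map Subtype.val) ?_ ?_
    · exact iff_of_eq (congrArg (x ∈ ·) (Walk.support_map (Embedding.induce S).toHom c))
    rw [List.mem_map]
    refine ⟨?_, fun hx => ⟨⟨x, hx⟩, (hs _).2 trivial, rfl⟩⟩
    rintro ⟨w, -, rfl⟩
    exact w.2
  · rintro ⟨a, c, hc, hs⟩
    have hS : ∀ z ∈ c.support, z ∈ S := fun z => (hs z).1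
    refine ⟨⟨a, hS _ c.start_mem_support⟩, c.induce S hS, ?_, fun x => ⟨fun _ => trivial, fun _ => ?_⟩⟩
    · have h := c.map_induce hS
      rw [← h] at hc
      exact Walk.IsCycle.of_map hc
    · rw [Walk.support_induce, List.mem_attachWith]
      exact (hs _).2 x.2

theorem isHCObstruction_iff : G.IsHCObstruction ↔ G.TwoConnectedOn Set.univ ∧
    ¬ G.HamiltonianOn Set.univ ∧
      ∀ S : Set V, S ≠ Set.univ → G.TwoConnectedOn S → G.HamiltonianOn S := by
  simp only [IsHCObstruction, isTwoConnected_induce_iff, hasHamiltonianCycle_induce_iff]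
  rw [isTwoConnected_iff_univ, hasHamiltonianCycle_iff]
  refine and_congr_right fun _ => and_congr_right fun _ => forall_congr' fun S => ?_
  tauto

/-- After the deletion of any one vertex `a ≠ x`, the vertex `x` still reaches a third vertex and so
has a neighbour other than `a`. Taking a neighbour of `x` for `a` gives the second one. -/
theorem TwoConnectedOn.exists_pair_adj (h : G.TwoConnectedOn S) (hx : x ∈ S) :
    ∃ a ∈ S, ∃ b ∈ S, a ≠ b ∧ G.Adj x a ∧ G.Adj x b := by
  obtain ⟨h3, h⟩ := h
  have nbr : ∀ a, a ≠ x → ∃ b ∈ S, b ≠ a ∧ G.Adj x b := by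
    intro a ha
    obtain ⟨y, hy, hyn⟩ : ∃ y ∈ S, y ∉ ({x, a} : Set V) := by
      refine Set.exists_mem_notMem_of_ncard_lt_ncard ?_
      have h2 := Set.ncard_insert_le x {a}
      rw [Set.ncard_singleton] at h2
      omega
    simp only [Set.mem_insert_iff, Set.mem_singleton_iff, not_or] at hyn
    obtain ⟨u, -, w, hw, hu, hwx, huw⟩ :=
      (h a x hx y hy ha.symm hyn.2).exists_adj_boundary (K := {x}) rfl hyn.1
    obtain rfl : u = x := hu
    exact ⟨w, hw.1, hw.2, huw⟩
  obtain ⟨y, hy, hyx⟩ : ∃ y ∈ S, y ∉ ({x} : Set V) := by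
    refine Set.exists_mem_notMem_of_ncard_lt_ncard ?_
    rw [Set.ncard_singleton]
    omega
  obtain ⟨a, ha, -, hxa⟩ := nbr y hyx
  obtain ⟨b, hb, hba, hxb⟩ := nbr a hxa.ne'
  exact ⟨a, ha, b, hb, hba.symm, hxa, hxb⟩

/-! ### Paths and cycles -/

namespace Walk

/-- The length condition excludes the closed walk that runs along one edge and back, and the trivial
walk. -/
theorem IsPath.isCycle_append_reverse {p q : G.Walk x y} (hp : p.IsPath) (hq : q.IsPath)
    (hd : ∀ z, z ∈ p.support → z ∈ q.support → z = x ∨ z = y)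
    (hl : 1 < p.length ∨ 1 < q.length) : (p.append q.reverse).IsCycle := by
  refine hp.isCycle_append hq.reverse ?_ (by simpa using hl)
  intro z hz1 hz2
  have h1 := List.mem_of_mem_tail hz1
  have h2 := List.mem_of_mem_tail hz2
  rw [support_reverse, List.mem_reverse] at h2
  rcases hd z h1 h2 with rfl | rfl
  · have := hp.support_nodup
    rw [← cons_tail_support] at this
    exact (List.nodup_cons.1 this).1 hz1
  · have := hq.reverse.support_nodup
    rw [← cons_tail_support] at this
    exact (List.nodup_cons.1 this).1 hz2

/-- Two distinct vertices of a cycle split it into two internally disjoint paths. -/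
theorem IsCycle.exists_arcs {a : V} {c : G.Walk a a} (hc : c.IsCycle) (hx : x ∈ c.support)
    (hy : y ∈ c.support) (hxy : x ≠ y) :
    ∃ p q : G.Walk x y, p.IsPath ∧ q.IsPath ∧
      p.length + q.length = c.length ∧
      (∀ z, z ∈ p.support → z ∈ q.support → z = x ∨ z = y) ∧
      (∀ z, z ∈ c.support ↔ z ∈ p.support ∨ z ∈ q.support) ∧
      ∀ e, e ∈ c.edges ↔ e ∈ p.edges ∨ e ∈ q.edges := by
  classical
  set d := c.rotate x hx with hd
  have hdc : d.IsCycle := (isCycle_rotate hx).2 hc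
  have hyd : y ∈ d.support := by simpa [hd] using hy
  have hspec := d.take_spec hyd
  have hcyc := hdc
  rw [← hspec] at hcyc
  refine ⟨d.takeUntil y hyd, (d.dropUntil y hyd).reverse, hdc.isPath_takeUntil hyd,
    (hcyc.isPath_of_append_right (not_nil_of_ne hxy)).reverse, ?_, ?_, ?_, ?_⟩
  · rw [length_reverse, ← length_append, hspec, hd, length_rotate]
  · intro z hz1 hz2
    rw [support_reverse, List.mem_reverse] at hz2
    by_contra! hne
    have hnd := hcyc.support_nodup
    rw [tail_support_append, List.nodup_append'] at hnd
    rw [← cons_tail_support, List.mem_cons] at hz1 hz2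
    exact hnd.2.2 (hz1.resolve_left hne.1) (hz2.resolve_left hne.2)
  · intro z
    have : z ∈ c.support ↔ z ∈ d.support := by simp [hd]
    rw [this, support_reverse, List.mem_reverse, ← mem_support_append_iff, hspec]
  · intro e
    have : e ∈ c.edges ↔ e ∈ d.edges := (c.rotate_edges x hx).mem_iff.symm
    rw [this, edges_reverse, List.mem_reverse, ← List.mem_append, ← edges_append, hspec]

/-- A cycle is an edge `xy` together with a path from `x` to `y`. -/
theorem IsCycle.exists_isPath_of_mem_edges {a : V} {c : G.Walk a a} (hc : c.IsCycle)
    (hxy : s(x, y) ∈ c.edges) :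
    ∃ p : G.Walk x y, p.IsPath ∧ 1 < p.length ∧ (∀ z, z ∈ c.support ↔ z ∈ p.support) ∧
      ∀ e, e ∈ c.edges → e = s(x, y) ∨ e ∈ p.edges := by
  have hadj : G.Adj x y := c.adj_of_mem_edges hxy
  obtain ⟨p, q, hp, hq, hl, hd, hs, he⟩ := hc.exists_arcs (c.fst_mem_support_of_mem_edges hxy)
    (c.snd_mem_support_of_mem_edges hxy) hadj.ne
  have key : ∀ p q : G.Walk x y, p.IsPath → q.IsPath → p.length + q.length = c.length →
      (∀ z, z ∈ c.support ↔ z ∈ p.support ∨ z ∈ q.support) →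
      (∀ e, e ∈ c.edges ↔ e ∈ p.edges ∨ e ∈ q.edges) → s(x, y) ∈ p.edges →
      ∃ p : G.Walk x y, p.IsPath ∧ 1 < p.length ∧ (∀ z, z ∈ c.support ↔ z ∈ p.support) ∧
      ∀ e, e ∈ c.edges → e = s(x, y) ∨ e ∈ p.edges := by
    intro p q hp hq hl hs he hxp
    -- A path from `x` to `y` that uses the edge `xy` is that edge, so the other arc carries the
    -- rest of the cycle.
    have hlen := hp.length_eq_one_of_mem_edges hxp
    have hc3 := hc.three_le_length
    refine ⟨q, hq, by omega, fun z => ⟨fun hz => ?_, fun hz => (hs z).2 (.inr hz)⟩, fun e h => ?_⟩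
    · rcases (hs z).1 hz with hz | hz
      · match p, hlen, hz with
        | .cons _ .nil, _, hz =>
          rcases (by simpa using hz : z = x ∨ z = y) with rfl | rfl
          · exact q.start_mem_support
          · exact q.end_mem_support
      · exact hz
    · refine ((he e).1 h).imp_left fun h => ?_
      match p, hlen, h with
      | .cons _ .nil, _, h => simpa using h
  rcases (he _).1 hxy with h | h
  · exact key p q hp hq hl hs he h
  · exact key q p hq hp (by omega) (fun z => by rw [hs, or_comm])
      (fun z => by rw [he, or_comm]) h

/-- A walk that is shortest among the walks inside its support is an induced path. -/
theorem isPath_and_isChordless_of_length_le {p : G.Walk x y}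
    (h : ∀ q : G.Walk x y, q.support ⊆ p.support → p.length ≤ q.length) :
    p.IsPath ∧ p.IsChordless := by
  classical
  have hp : p.IsPath := by
    have h1 := h p.bypass p.support_bypass_subset_support
    have h2 := p.support_bypass_sublist_support.eq_of_length_le (by simpa using h1)
    exact IsPath.mk' (h2 ▸ p.bypass_isPath.support_nodup)
  refine ⟨hp, isChordless_iff_forall_mem_edges.2 ?_⟩
  -- An edge between the vertices at positions `i < j` is a shortcut inside the support; minimality
  -- forces `j = i + 1`.
  have key : ∀ i j, i < j → j ≤ p.length → G.Adj (p.getVert i) (p.getVert j) → j = i + 1 := by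
    intro i j hij hj hadj
    have h1 := h ((p.take i).append (.cons hadj (p.drop j))) ?_
    · simp at h1
      omega
    · intro z hz
      rw [mem_support_append_iff, support_cons, List.mem_cons, support_take,
        drop_support_eq_support_drop_min] at hz
      rcases hz with hz | rfl | hz
      · exact List.mem_of_mem_take hz
      · exact p.getVert_mem_support _
      · exact List.mem_of_mem_drop hz
  have edge : ∀ i < p.length, s(p.getVert i, p.getVert (i + 1)) ∈ p.edges := fun i hi =>
    (p.mk_mem_edges_iff_exists).2 ⟨i, hi, rfl⟩
  intro u v hu hv huv
  obtain ⟨i, rfl, hi⟩ := mem_support_iff_exists_getVert.1 hu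
  obtain ⟨j, rfl, hj⟩ := mem_support_iff_exists_getVert.1 hv
  rcases lt_trichotomy i j with hij | rfl | hij
  · obtain rfl := key i j hij hj huv
    exact edge i (by omega)
  · exact absurd rfl huv.ne
  · obtain rfl := key j i hij hi huv.symm
    rw [Sym2.eq_swap]
    exact edge j (by omega)

end Walk

/-- Vertices that are joined by a walk inside `S` are joined by an induced path inside `S`. -/
theorem ReachableIn.exists_isPath_isChordless (h : G.ReachableIn S x y) :
    ∃ p : G.Walk x y, p.IsPath ∧ p.IsChordless ∧ ∀ z ∈ p.support, z ∈ S := by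
  classical
  obtain ⟨p, hp⟩ := h
  induction hn : p.length using Nat.strong_induction_on generalizing p with
  | _ n ih =>
    by_cases hmin : ∀ q : G.Walk x y, q.support ⊆ p.support → p.length ≤ q.length
    · have := Walk.isPath_and_isChordless_of_length_le hmin
      exact ⟨p, this.1, this.2, hp⟩
    · push Not at hmin
      obtain ⟨q, hq, hlt⟩ := hmin
      exact ih q.length (hn ▸ hlt) q (fun z hz => hp z (hq hz)) rfl

/-! ### Thetas and closed thetas -/

namespace Walk

/-- The vertex `x` cuts the path into two parts that share only `x`, so `w` lies on at most one of
them. -/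
theorem IsPath.reachableIn_start_or_end {p : G.Walk u v} (hp : p.IsPath) (hx : x ∈ p.support)
    (hxw : x ≠ w) : G.ReachableIn ({z | z ∈ p.support} \ {w}) x u ∨
      G.ReachableIn ({z | z ∈ p.support} \ {w}) x v := by
  classical
  by_cases h1 : w ∈ (p.takeUntil x hx).support
  · by_cases h2 : w ∈ (p.dropUntil x hx).support
    · exfalso
      have hnd := hp.support_nodup
      rw [← p.take_spec hx, support_append, List.nodup_append'] at hnd
      rw [← cons_tail_support, List.mem_cons] at h2
      exact hnd.2.2 h1 (h2.resolve_left hxw.symm)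
    · exact .inr ⟨p.dropUntil x hx, fun z hz =>
        ⟨p.support_dropUntil_subset_support hx hz, fun h => h2 (h ▸ hz)⟩⟩
  · refine .inl (.symm ⟨p.takeUntil x hx, fun z hz =>
      ⟨p.support_takeUntil_subset_support hx hz, fun h => h1 (h ▸ hz)⟩⟩)

theorem IsPath.exists_interior {p : G.Walk x y} (hp : p.IsPath) (hl : 2 ≤ p.length) :
    ∃ z ∈ p.support, z ≠ x ∧ z ≠ y := by
  refine ⟨p.getVert 1, p.getVert_mem_support 1, ?_⟩
  rw [Ne, hp.getVert_eq_start_iff (by omega), Ne, hp.getVert_eq_end_iff (by omega)]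
  omega

/-- The interior of a path is connected. -/
theorem IsPath.reachableIn_interior {p : G.Walk u v} (hp : p.IsPath) (hx : x ∈ p.support)
    (hy : y ∈ p.support) (hx' : x ≠ u ∧ x ≠ v) (hy' : y ≠ u ∧ y ≠ v) :
    G.ReachableIn ({z | z ∈ p.support} \ {u, v}) x y := by
  have key : ∀ i, 0 < i → ∀ n, i + n < p.length →
      G.ReachableIn ({z | z ∈ p.support} \ {u, v}) (p.getVert i) (p.getVert (i + n)) := by
    have mem : ∀ m, 0 < m → m < p.length → p.getVert m ∈ {z | z ∈ p.support} \ {u, v} := by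
      intro m h0 hm
      refine ⟨p.getVert_mem_support m, ?_⟩
      rw [Set.mem_insert_iff, Set.mem_singleton_iff, hp.getVert_eq_start_iff hm.le,
        hp.getVert_eq_end_iff hm.le]
      omega
    intro i hi n
    induction n with
    | zero => exact fun h => .refl (mem _ hi h)
    | succ n ih =>
      intro h
      exact (ih (by omega)).trans (.of_adj (mem _ (by omega) (by omega))
        (mem _ (by omega) (by omega)) (p.adj_getVert_succ (by omega)))
  obtain ⟨i, rfl, hi⟩ := mem_support_iff_exists_getVert.1 hx
  obtain ⟨j, rfl, hj⟩ := mem_support_iff_exists_getVert.1 hy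
  rw [Ne, hp.getVert_eq_start_iff hi, Ne, hp.getVert_eq_end_iff hi] at hx'
  rw [Ne, hp.getVert_eq_start_iff hj, Ne, hp.getVert_eq_end_iff hj] at hy'
  rcases le_total i j with h | h
  · obtain ⟨n, rfl⟩ := Nat.exists_eq_add_of_le h
    exact key i (by omega) n (by omega)
  · obtain ⟨n, rfl⟩ := Nat.exists_eq_add_of_le h
    exact (key j (by omega) n (by omega)).symm

end Walk

/-- The subgraph induced on `T` consists of the three internally disjoint paths `P i` of length at
least two, and possibly the edge between their ends: it is a theta or a closed theta. -/
structure ThreePathOn (G : SimpleGraph V) (T : Set V) (P : Fin 3 → G.Walk u v) : Prop where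
  ne : u ≠ v
  isPath : ∀ i, (P i).IsPath
  two_le : ∀ i, 2 ≤ (P i).length
  disj : ∀ i j, i ≠ j → ∀ x, x ∈ (P i).support → x ∈ (P j).support → x = u ∨ x = v
  mem_iff : ∀ x, x ∈ T ↔ ∃ i, x ∈ (P i).support
  edge : ∀ x ∈ T, ∀ y ∈ T, G.Adj x y → (∃ i, s(x, y) ∈ (P i).edges) ∨ s(x, y) = s(u, v)

namespace ThreePathOn

variable {P : Fin 3 → G.Walk u v}

/-- An interior vertex lies on no other path, and the only edge allowed off the paths joins the
ends. -/
theorem mem_edges (h : G.ThreePathOn T P) {i : Fin 3} (hx : x ∈ (P i).support) (hxu : x ≠ u)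
    (hxv : x ≠ v) (hy : y ∈ T) (hxy : G.Adj x y) : s(x, y) ∈ (P i).edges := by
  rcases h.edge x ((h.mem_iff x).2 ⟨i, hx⟩) y hy hxy with ⟨j, hj⟩ | he
  · by_cases hij : i = j
    · rwa [hij]
    · rcases h.disj i j hij x hx ((P j).fst_mem_support_of_mem_edges hj) with rfl | rfl
      exacts [absurd rfl hxu, absurd rfl hxv]
  · rcases Sym2.eq_iff.1 he with h | h
    exacts [absurd h.1 hxu, absurd h.1 hxv]

theorem exists_interior (h : G.ThreePathOn T P) (i : Fin 3) :
    ∃ x ∈ (P i).support, x ≠ u ∧ x ≠ v :=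
  (h.isPath i).exists_interior (h.two_le i)

theorem twoConnectedOn [Finite V] (h : G.ThreePathOn T P) : G.TwoConnectedOn T := by
  have hsub : ∀ i w, {z | z ∈ (P i).support} \ {w} ⊆ T \ {w} := fun i w =>
    Set.sdiff_subset_sdiff_left fun z hz => (h.mem_iff z).2 ⟨i, hz⟩
  constructor
  · obtain ⟨x, hx, hxu, hxv⟩ := h.exists_interior 0
    refine (Set.two_lt_ncard (Set.toFinite _)).2 ⟨u, ?_, v, ?_, x, ?_, h.ne, hxu.symm, hxv.symm⟩
    · exact (h.mem_iff u).2 ⟨0, (P 0).start_mem_support⟩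
    · exact (h.mem_iff v).2 ⟨0, (P 0).end_mem_support⟩
    · exact (h.mem_iff x).2 ⟨0, hx⟩
  · intro w
    -- Every remaining vertex reaches an end along its own path. If both ends remain, some path
    -- avoids `w` and joins them.
    obtain ⟨b, hb⟩ : ∃ b, ∀ x ∈ T, x ≠ w → G.ReachableIn (T \ {w}) x b := by
      by_cases hu : u = w
      · refine ⟨v, fun x hx hxw => ?_⟩
        obtain ⟨i, hi⟩ := (h.mem_iff x).1 hx
        rcases (h.isPath i).reachableIn_start_or_end hi hxw with hr | hr
        · exact absurd hu hr.right_mem.2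
        · exact hr.mono (hsub i w)
      by_cases hv : v = w
      · refine ⟨u, fun x hx hxw => ?_⟩
        obtain ⟨i, hi⟩ := (h.mem_iff x).1 hx
        rcases (h.isPath i).reachableIn_start_or_end hi hxw with hr | hr
        · exact hr.mono (hsub i w)
        · exact absurd hv hr.right_mem.2
      obtain ⟨j, hj⟩ : ∃ j, w ∉ (P j).support := by
        by_contra! hc
        rcases h.disj 0 1 (by decide) w (hc 0) (hc 1) with rfl | rfl
        exacts [hu rfl, hv rfl]
      have huv : G.ReachableIn (T \ {w}) v u := by
        refine .symm ⟨P j, fun z hz => hsub j w ⟨hz, ?_⟩⟩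
        rintro rfl
        exact hj hz
      refine ⟨u, fun x hx hxw => ?_⟩
      obtain ⟨i, hi⟩ := (h.mem_iff x).1 hx
      rcases (h.isPath i).reachableIn_start_or_end hi hxw with hr | hr
      · exact hr.mono (hsub i w)
      · exact (hr.mono (hsub i w)).trans huv
    exact fun x hx y hy hxw hyw => (hb x hx hxw).trans (hb y hy hyw).symm

theorem not_hamiltonianOn (h : G.ThreePathOn T P) : ¬ G.HamiltonianOn T := by
  rintro ⟨a, c, hc, hcT⟩
  have hu : u ∈ c.support := (hcT u).2 ((h.mem_iff u).2 ⟨0, (P 0).start_mem_support⟩)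
  have hv : v ∈ c.support := (hcT v).2 ((h.mem_iff v).2 ⟨0, (P 0).end_mem_support⟩)
  obtain ⟨p, q, hp, hq, -, -, hs, -⟩ := hc.exists_arcs hu hv h.ne
  -- The interior of an arc `r` is connected and avoids `u` and `v`, so it cannot pass from one path
  -- to another. The rest is the pigeonhole principle for three interior vertices `m i` and two
  -- arcs.
  have mono : ∀ r : G.Walk u v, r.IsPath → (∀ z ∈ r.support, z ∈ T) → ∀ i j x y,
      x ∈ r.support → y ∈ r.support → x ∈ (P i).support → y ∈ (P j).support →
      x ≠ u ∧ x ≠ v → y ≠ u ∧ y ≠ v → i = j := by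
    intro r hr hrT i j x y hx hy hxi hyj hx' hy'
    have := (hr.reachableIn_interior hx hy hx' hy').mem_of_closed
      (K := {z | z ∈ (P i).support ∧ z ≠ u ∧ z ≠ v}) ⟨hxi, hx'⟩ ?_
    · by_contra hij
      rcases h.disj i j hij y this.1 hyj with rfl | rfl
      exacts [hy'.1 rfl, hy'.2 rfl]
    · rintro a ⟨ha, hau, hav⟩ b ⟨hb, hbn⟩ hab
      refine ⟨(P i).snd_mem_support_of_mem_edges (h.mem_edges ha hau hav (hrT b hb) hab), ?_⟩
      simpa using hbn
  have hpT : ∀ z ∈ p.support, z ∈ T := fun z hz => (hcT z).1 ((hs z).2 (.inl hz))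
  have hqT : ∀ z ∈ q.support, z ∈ T := fun z hz => (hcT z).1 ((hs z).2 (.inr hz))
  choose m hm hmu using h.exists_interior
  have cov : ∀ i, m i ∈ p.support ∨ m i ∈ q.support := fun i =>
    (hs _).1 ((hcT _).2 ((h.mem_iff _).2 ⟨i, hm i⟩))
  have key : ∀ i j, i ≠ j → (m i ∈ p.support → m j ∉ p.support) ∧
      (m i ∈ q.support → m j ∉ q.support) := fun i j hij =>
    ⟨fun h1 h2 => hij (mono p hp hpT i j _ _ h1 h2 (hm i) (hm j) (hmu i) (hmu j)),
      fun h1 h2 => hij (mono q hq hqT i j _ _ h1 h2 (hm i) (hm j) (hmu i) (hmu j))⟩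
  rcases cov 0 with c0 | c0 <;> rcases cov 1 with c1 | c1 <;> rcases cov 2 with c2 | c2
  exacts [(key 0 1 (by decide)).1 c0 c1, (key 0 1 (by decide)).1 c0 c1,
    (key 0 2 (by decide)).1 c0 c2, (key 1 2 (by decide)).2 c1 c2,
    (key 1 2 (by decide)).1 c1 c2, (key 0 2 (by decide)).2 c0 c2,
    (key 0 1 (by decide)).2 c0 c1, (key 0 1 (by decide)).2 c0 c1]

/-- An interior vertex of a path has only its two path neighbours in `T`, and it needs two
neighbours in `S`. Membership in `S` therefore spreads along the path in both directions. -/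
theorem support_subset (h : G.ThreePathOn T P) (hS : G.TwoConnectedOn S) (hST : S ⊆ T)
    {i : Fin 3} (hxS : x ∈ S) (hx : x ∈ (P i).support) (hxu : x ≠ u) (hxv : x ≠ v) :
    ∀ z ∈ (P i).support, z ∈ S := by
  have hp := h.isPath i
  have step : ∀ k, 0 < k → k < (P i).length → (P i).getVert k ∈ S →
      (P i).getVert (k - 1) ∈ S ∧ (P i).getVert (k + 1) ∈ S := by
    intro k h0 hk hkS
    obtain ⟨a, ha, b, hb, hab, hka, hkb⟩ := hS.exists_pair_adj hkS
    have hn := hp.neighborSet_toSubgraph_internal h0.ne' hk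
    have hne : (P i).getVert k ≠ u ∧ (P i).getVert k ≠ v := by
      rw [Ne, hp.getVert_eq_start_iff hk.le, Ne, hp.getVert_eq_end_iff hk.le]
      omega
    have mem : ∀ a ∈ S, G.Adj ((P i).getVert k) a →
        a = (P i).getVert (k - 1) ∨ a = (P i).getVert (k + 1) := by
      intro a ha hka
      have : a ∈ (P i).toSubgraph.neighborSet ((P i).getVert k) :=
        Walk.adj_toSubgraph_iff_mem_edges.2
          (h.mem_edges ((P i).getVert_mem_support k) hne.1 hne.2 (hST ha) hka)
      rw [hn] at this
      simpa using this
    rcases mem a ha hka with rfl | rfl <;> rcases mem b hb hkb with rfl | rfl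
    exacts [absurd rfl hab, ⟨ha, hb⟩, ⟨hb, ha⟩, absurd rfl hab]
  obtain ⟨k, rfl, hk⟩ := Walk.mem_support_iff_exists_getVert.1 hx
  rw [Ne, hp.getVert_eq_start_iff hk] at hxu
  rw [Ne, hp.getVert_eq_end_iff hk] at hxv
  have up : ∀ n, k + n ≤ (P i).length → (P i).getVert (k + n) ∈ S := by
    intro n
    induction n with
    | zero => exact fun _ => hxS
    | succ n ih => exact fun hn => (step (k + n) (by omega) (by omega) (ih (by omega))).2
  have down : ∀ n, n ≤ k → (P i).getVert (k - n) ∈ S := by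
    intro n
    induction n with
    | zero => exact fun _ => hxS
    | succ n ih => exact fun hn => (step (k - n) (by omega) (by omega) (ih (by omega))).1
  intro z hz
  obtain ⟨m, rfl, hm⟩ := Walk.mem_support_iff_exists_getVert.1 hz
  rcases le_total k m with hkm | hkm
  · obtain ⟨n, rfl⟩ := Nat.exists_eq_add_of_le hkm
    exact up n hm
  · have := down (k - m) (by omega)
    rwa [Nat.sub_sub_self hkm] at this

/-- By `support_subset`, `S` is a union of whole paths, and not of all three. Two paths form a
cycle; a single path is closed up by the edge `uv`. -/
theorem hamiltonianOn_of_ssubset (h : G.ThreePathOn T P) (hST : S ⊆ T) (hne : S ≠ T)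
    (hS : G.TwoConnectedOn S) : G.HamiltonianOn S := by
  obtain ⟨k, hk⟩ : ∃ k, ¬ ∀ z ∈ (P k).support, z ∈ S := by
    by_contra! hc
    refine hne (hST.antisymm fun z hz => ?_)
    obtain ⟨i, hi⟩ := (h.mem_iff z).1 hz
    exact hc i z hi
  obtain ⟨i, hi⟩ : ∃ i, ∀ z ∈ (P i).support, z ∈ S := by
    obtain ⟨x, hx, hxn⟩ : ∃ x ∈ S, x ∉ ({u, v} : Set V) := by
      refine Set.exists_mem_notMem_of_ncard_lt_ncard ?_
      have h2 := Set.ncard_insert_le u {v}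
      rw [Set.ncard_singleton] at h2
      have := hS.1
      omega
    simp only [Set.mem_insert_iff, Set.mem_singleton_iff, not_or] at hxn
    obtain ⟨i, hi⟩ := (h.mem_iff x).1 (hST hx)
    exact ⟨i, h.support_subset hS hST hx hi hxn.1 hxn.2⟩
  have hu : u ∈ S := hi u (P i).start_mem_support
  have hv : v ∈ S := hi v (P i).end_mem_support
  have cov : ∀ z ∈ S, z = u ∨ z = v ∨ ∃ j, z ∈ (P j).support ∧ ∀ z ∈ (P j).support, z ∈ S := by
    intro z hz
    by_cases hzu : z = u
    · exact .inl hzu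
    by_cases hzv : z = v
    · exact .inr (.inl hzv)
    obtain ⟨j, hj⟩ := (h.mem_iff z).1 (hST hz)
    exact .inr (.inr ⟨j, hj, h.support_subset hS hST hz hj hzu hzv⟩)
  by_cases hj : ∃ j, j ≠ i ∧ ∀ z ∈ (P j).support, z ∈ S
  · obtain ⟨j, hji, hj⟩ := hj
    refine ⟨u, (P i).append (P j).reverse, (h.isPath i).isCycle_append_reverse (h.isPath j)
      (h.disj i j hji.symm) (.inl (h.two_le i)), fun z => ?_⟩
    rw [Walk.mem_support_append_iff, Walk.support_reverse, List.mem_reverse]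
    refine ⟨fun hz => hz.elim (hi z) (hj z), fun hz => ?_⟩
    rcases cov z hz with rfl | rfl | ⟨l, hl, hlS⟩
    · exact .inl (P i).start_mem_support
    · exact .inl (P i).end_mem_support
    · have hlk : l ≠ k := by
        rintro rfl
        exact hk hlS
      have hik : i ≠ k := by
        rintro rfl
        exact hk hi
      have hjk : j ≠ k := by
        rintro rfl
        exact hk hj
      have : l = i ∨ l = j := by omega
      rcases this with rfl | rfl
      exacts [.inl hl, .inr hl]
  · have hSi : ∀ z, z ∈ (P i).support ↔ z ∈ S := by
      refine fun z => ⟨hi z, fun hz => ?_⟩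
      rcases cov z hz with rfl | rfl | ⟨l, hl, hlS⟩
      · exact (P i).start_mem_support
      · exact (P i).end_mem_support
      · by_cases hli : l = i
        · rwa [← hli]
        · exact absurd ⟨l, hli, hlS⟩ hj
    have hadj : G.Adj u v := by
      -- Without the edge `uv`, the end `u` would have only one neighbour in `S`, the second vertex
      -- of the path.
      by_contra hnadj
      obtain ⟨a, ha, b, hb, hab, hua, hub⟩ := hS.exists_pair_adj hu
      have key : ∀ a ∈ S, G.Adj u a → (P i).snd = a := by
        intro a ha hua
        refine (h.isPath i).snd_of_toSubgraph_adj (Walk.adj_toSubgraph_iff_mem_edges.2 ?_)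
        have hav : a ≠ v := by
          rintro rfl
          exact hnadj hua
        have := h.mem_edges ((hSi a).2 ha) hua.ne' hav (hST hu) hua.symm
        rwa [Sym2.eq_swap]
      exact hab ((key a ha hua).symm.trans (key b hb hub))
    refine ⟨v, .cons hadj.symm (P i), (Walk.cons_isCycle_iff _ _).2 ⟨h.isPath i, fun he => ?_⟩,
      fun z => ?_⟩
    · rw [Sym2.eq_swap] at he
      have := (h.isPath i).length_eq_one_of_mem_edges he
      have := h.two_le i
      omega
    · rw [Walk.support_cons, List.mem_cons, hSi]
      refine ⟨?_, .inr⟩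
      rintro (rfl | hz)
      exacts [hv, hz]

end ThreePathOn

/-! ### Wheels -/

theorem CliqueFree.not_adj_of_adj_of_adj (h : G.CliqueFree 3) (hxy : G.Adj x y)
    (hxz : G.Adj x z) : ¬ G.Adj y z := by
  classical
  exact fun hyz => h {x, y, z} (is3Clique_triple_iff.2 ⟨hxy, hxz, hyz⟩)

namespace Walk

theorem two_le_length_of_not_adj (p : G.Walk x y) (hne : x ≠ y) (h : ¬ G.Adj x y) :
    2 ≤ p.length := by
  match p with
  | .nil => exact absurd rfl hne
  | .cons hadj .nil => exact absurd hadj h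
  | .cons _ (.cons _ _) => simp

theorem IsCycle.reachableIn_sdiff_singleton {a : V} {c : G.Walk a a} (hc : c.IsCycle)
    (hx : x ∈ c.support) (hy : y ∈ c.support) (hxw : x ≠ w) (hyw : y ≠ w) :
    G.ReachableIn ({z | z ∈ c.support} \ {w}) x y := by
  by_cases hxy : x = y
  · exact hxy ▸ .refl ⟨hx, hxw⟩
  obtain ⟨p, q, -, -, -, hd, hs, -⟩ := hc.exists_arcs hx hy hxy
  by_cases hwp : w ∈ p.support
  · refine ⟨q, fun z hz => ⟨(hs z).2 (.inr hz), ?_⟩⟩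
    rintro rfl
    rcases hd z hwp hz with rfl | rfl
    exacts [hxw rfl, hyw rfl]
  · refine ⟨p, fun z hz => ⟨(hs z).2 (.inl hz), ?_⟩⟩
    rintro rfl
    exact hwp hz

/-- Deleting a vertex from a cycle leaves a path. -/
theorem IsCycle.exists_isPath_of_mem_support {a : V} {c : G.Walk a a} (hc : c.IsCycle)
    (hw : w ∈ c.support) :
    ∃ (x y : V) (q : G.Walk x y), q.IsPath ∧ x ≠ y ∧ G.Adj w x ∧ G.Adj w y ∧
      (∀ z, z ∈ q.support ↔ z ∈ c.support ∧ z ≠ w) ∧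
      ∀ e ∈ c.edges, w ∉ e → e ∈ q.edges := by
  classical
  have hd : (c.rotate w hw).IsCycle := (isCycle_rotate hw).2 hc
  have hs : ∀ z, z ∈ c.support ↔ z ∈ (c.rotate w hw).support := by simp
  have he : ∀ e, e ∈ c.edges ↔ e ∈ (c.rotate w hw).edges := fun e =>
    (c.rotate_edges w hw).mem_iff.symm
  simp only [hs, he]
  -- With the cycle based at `w`, removing its first and last edges leaves the path.
  generalize c.rotate w hw = d at hd
  match d, hd with
  | .nil, hd => exact absurd hd not_isCycle_nil
  | .cons (v := y) hy r, hd =>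
    rw [cons_isCycle_iff] at hd
    obtain ⟨r, rfl⟩ : ∃ r' : G.Walk w y, r = r'.reverse := ⟨r.reverse, by simp⟩
    rw [isPath_reverse_iff, edges_reverse, List.mem_reverse] at hd
    cases r with
    | nil => exact absurd hy (G.loopless.irrefl _)
    | @cons _ x _ hx q =>
      rw [cons_isPath_iff] at hd
      refine ⟨x, y, q, hd.1.1, ?_, hx, hy, fun z => ?_, fun e => ?_⟩
      · rintro rfl
        exact hd.2 (by simp)
      · simp only [support_cons, List.mem_cons, support_reverse, List.mem_reverse]
        constructor
        · intro hz
          refine ⟨.inr (.inr hz), ?_⟩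
          rintro rfl
          exact hd.1.2 hz
        · rintro ⟨hz, hzw⟩
          exact (hz.resolve_left hzw).resolve_left hzw
      · simp only [edges_cons, edges_reverse, List.mem_cons, List.mem_reverse]
        rintro (rfl | rfl | he) hwe
        · exact absurd (Sym2.mem_mk_left _ _) hwe
        · exact absurd (Sym2.mem_mk_left _ _) hwe
        · exact he

theorem IsPath.adj_getVert_iff {p : G.Walk x y} (hp : p.IsPath) (hc : p.IsChordless) {i j : ℕ}
    (hi : i ≤ p.length) (hj : j ≤ p.length) :
    G.Adj (p.getVert i) (p.getVert j) → j = i + 1 ∨ i = j + 1 := by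
  intro h
  obtain ⟨k, hk, he⟩ := (p.mk_mem_edges_iff_exists).1
    (hc.mem_edges (p.getVert_mem_support i) (p.getVert_mem_support j) h)
  have inj : ∀ {m n}, m ≤ p.length → n ≤ p.length → p.getVert m = p.getVert n → m = n :=
    fun hm hn h => hp.getVert_injOn hm hn h
  rcases Sym2.eq_iff.1 he with ⟨h1, h2⟩ | ⟨h1, h2⟩
  · have := inj hk.le hi h1
    have := inj hk hj h2
    omega
  · have := inj hk.le hj h1
    have := inj hk hi h2
    omega

theorem IsPath.exists_subpath {p : G.Walk x y} (hp : p.IsPath) {i j : ℕ} (hij : i ≤ j)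
    (hj : j ≤ p.length) : ∃ q : G.Walk (p.getVert i) (p.getVert j), q.IsPath ∧
      ∀ z, z ∈ q.support ↔ ∃ k, i ≤ k ∧ k ≤ j ∧ p.getVert k = z := by
  have he : (p.drop i).getVert (j - i) = p.getVert j := by
    rw [drop_getVert, Nat.add_sub_cancel' hij]
  refine ⟨((p.drop i).take (j - i)).copy rfl he, ?_, fun z => ?_⟩
  · rw [isPath_copy]
    exact (hp.drop i).take (j - i)
  · rw [support_copy, mem_support_iff_exists_getVert]
    simp only [take_getVert, drop_getVert, take_length, drop_length]
    constructor
    · rintro ⟨n, rfl, hn⟩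
      exact ⟨_, by omega, by omega, rfl⟩
    · rintro ⟨k, hk, hk', rfl⟩
      exact ⟨k - i, by congr 1; omega, by omega⟩

end Walk

/-- A 2-connected subset of an induced path and one further vertex is a cycle through this
vertex. -/
theorem TwoConnectedOn.hamiltonianOn_of_subset_insert {p : G.Walk x y} (hp : p.IsPath)
    (hc : p.IsChordless) (hS : G.TwoConnectedOn S) (hvp : v ∉ p.support)
    (hSp : ∀ z ∈ S, z = v ∨ z ∈ p.support) : G.HamiltonianOn S := by
  classical
  have hidx : ∀ z ∈ S, z ≠ v → ∃ k ≤ p.length, p.getVert k = z := by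
    intro z hz hzv
    obtain ⟨k, hk, hk'⟩ := Walk.mem_support_iff_exists_getVert.1 ((hSp z hz).resolve_left hzv)
    exact ⟨k, hk', hk⟩
  have hne : ∀ k, p.getVert k ≠ v := fun k h => hvp (h ▸ p.getVert_mem_support k)
  have nbr : ∀ k ≤ p.length, ∀ z ∈ S, G.Adj (p.getVert k) z →
      z = v ∨ (k < p.length ∧ z = p.getVert (k + 1)) ∨ (0 < k ∧ z = p.getVert (k - 1)) := by
    intro k hk z hz hkz
    by_cases hzv : z = v
    · exact .inl hzv
    obtain ⟨j, hj, rfl⟩ := hidx z hz hzv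
    rcases hp.adj_getVert_iff hc hk hj hkz with rfl | rfl
    · exact .inr (.inl ⟨by omega, rfl⟩)
    · exact .inr (.inr ⟨by omega, rfl⟩)
  have hex : ∃ k, k ≤ p.length ∧ p.getVert k ∈ S := by
    obtain ⟨z, hz, hzv⟩ : ∃ z ∈ S, z ∉ ({v} : Set V) := by
      refine Set.exists_mem_notMem_of_ncard_lt_ncard ?_
      rw [Set.ncard_singleton]
      have := hS.1
      omega
    obtain ⟨k, hk, rfl⟩ := hidx z hz hzv
    exact ⟨k, hk, hz⟩
  -- The first position on the path that belongs to `S`. With nothing before it, its two neighbours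
  -- in `S` must be `v` and the next vertex.
  obtain ⟨i, ⟨hi, hiS⟩, himin⟩ : ∃ i, (i ≤ p.length ∧ p.getVert i ∈ S) ∧
      ∀ k < i, p.getVert k ∉ S :=
    ⟨Nat.find hex, Nat.find_spec hex, fun k hk h => Nat.find_min hex hk
      ⟨hk.le.trans (Nat.find_spec hex).1, h⟩⟩
  have first : v ∈ S ∧ G.Adj (p.getVert i) v ∧ i < p.length ∧ p.getVert (i + 1) ∈ S := by
    obtain ⟨a, ha, b, hb, hab, hia, hib⟩ := hS.exists_pair_adj hiS
    have key : ∀ a ∈ S, G.Adj (p.getVert i) a →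
        a = v ∨ (i < p.length ∧ a = p.getVert (i + 1)) := by
      intro a ha hia
      rcases nbr i hi a ha hia with h | h | ⟨h0, rfl⟩
      exacts [.inl h, .inr h, absurd ha (himin _ (by omega))]
    rcases key a ha hia with rfl | ⟨h1, rfl⟩ <;> rcases key b hb hib with rfl | ⟨h2, rfl⟩
    exacts [absurd rfl hab, ⟨ha, hia, h2, hb⟩, ⟨hb, hib, h1, ha⟩, absurd rfl hab]
  obtain ⟨hvS, hiv, hil, hi1⟩ := first
  -- The last position of the run in `S` that starts at `i`. The search starts at `i + 1`, already
  -- known to be in `S`, so that `i < j`.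
  obtain ⟨j, ⟨hij, hj, hjS⟩, hjmax⟩ : ∃ j, (i < j ∧ j ≤ p.length ∧
      ∀ k, i ≤ k → k ≤ j → p.getVert k ∈ S) ∧ (j < p.length → p.getVert (j + 1) ∉ S) := by
    have hb : ∃ d, i + 1 + d = p.length ∨ p.getVert (i + 1 + d + 1) ∉ S :=
      ⟨p.length - (i + 1), .inl (by omega)⟩
    have hmin : ∀ d < Nat.find hb, i + 1 + d ≠ p.length ∧ p.getVert (i + 1 + d + 1) ∈ S := by
      intro d hd
      simpa using Nat.find_min hb hd
    refine ⟨i + 1 + Nat.find hb, ⟨by omega, ?_, fun k hk hk' => ?_⟩, fun h => ?_⟩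
    · by_contra! hlt
      exact (hmin (p.length - (i + 1)) (by omega)).1 (by omega)
    · by_cases h1 : k = i
      · rwa [h1]
      by_cases h2 : k = i + 1
      · rwa [h2]
      have := (hmin (k - (i + 2)) (by omega)).2
      rwa [show i + 1 + (k - (i + 2)) + 1 = k by omega] at this
    · exact (Nat.find_spec hb).resolve_left h.ne
  have hjv : G.Adj (p.getVert j) v := by
    obtain ⟨a, ha, b, hb, hab, hja, hjb⟩ := hS.exists_pair_adj (hjS j hij.le le_rfl)
    have key : ∀ a ∈ S, G.Adj (p.getVert j) a → a = v ∨ a = p.getVert (j - 1) := by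
      intro a ha hja
      rcases nbr j hj a ha hja with h | ⟨h, rfl⟩ | ⟨h0, h⟩
      exacts [.inl h, absurd ha (hjmax h), .inr h]
    rcases key a ha hja with rfl | rfl
    · exact hja
    · rcases key b hb hjb with rfl | rfl
      exacts [hjb, absurd rfl hab]
  -- `S` without `v` is connected, and no edge leaves the run at either end, so the run is
  -- everything.
  have hS_eq : ∀ z ∈ S, z ≠ v → ∃ k, i ≤ k ∧ k ≤ j ∧ p.getVert k = z := by
    intro z hz hzv
    refine (hS.2 v _ hiS z hz (hne i) hzv).mem_of_closed
      (K := {z | ∃ k, i ≤ k ∧ k ≤ j ∧ p.getVert k = z}) ⟨i, le_rfl, hij.le, rfl⟩ ?_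
    rintro _ ⟨k, hk, hk', rfl⟩ b ⟨hbS, hbv⟩ hkb
    rcases nbr k (hk'.trans hj) b hbS hkb with h | ⟨h, rfl⟩ | ⟨h, rfl⟩
    · exact absurd h hbv
    · refine ⟨k + 1, by omega, ?_, rfl⟩
      by_contra! hlt
      obtain rfl : k = j := by omega
      exact hjmax h hbS
    · refine ⟨k - 1, ?_, by omega, rfl⟩
      by_contra! hlt
      exact himin _ hlt hbS
  obtain ⟨q, hq, hqs⟩ := hp.exists_subpath hij.le hj
  have hneij : p.getVert i ≠ p.getVert j := fun h => hij.ne (hp.getVert_injOn hi hj h)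
  refine ⟨_, q.append (Walk.cons hiv (.cons hjv.symm .nil)).reverse,
    hq.isCycle_append_reverse ?_ ?_ (.inr (by simp)), fun z => ?_⟩
  · simp [Walk.cons_isPath_iff, hneij, hne, (hne _).symm]
  · intro z hz hz'
    rcases (by simpa using hz' : z = p.getVert i ∨ z = v ∨ z = p.getVert j) with h | rfl | h
    · exact .inl h
    · obtain ⟨k, -, -, h⟩ := (hqs z).1 hz
      exact absurd h (hne k)
    · exact .inr h
  · rw [Walk.mem_support_append_iff, Walk.support_reverse, List.mem_reverse, hqs]
    constructor
    · rintro (⟨k, hk, hk', rfl⟩ | hz)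
      · exact hjS k hk hk'
      · rcases (by simpa using hz : z = p.getVert i ∨ z = v ∨ z = p.getVert j) with rfl | rfl | rfl
        exacts [hiS, hvS, hjS j hij.le le_rfl]
    · intro hz
      by_cases hzv : z = v
      · exact .inr (by simp [hzv])
      · exact .inl (hS_eq z hz hzv)

/-- The subgraph induced on `T` is a wheel with rim `c` and hub `v`. -/
structure WheelOn (G : SimpleGraph V) (T : Set V) (v : V) {a : V} (c : G.Walk a a) : Prop where
  isCycle : c.IsCycle
  isChordless : c.IsChordless
  notMem : v ∉ c.support
  mem_iff : ∀ x, x ∈ T ↔ x = v ∨ x ∈ c.support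
  three_le : 3 ≤ {x | x ∈ c.support ∧ G.Adj v x}.ncard

namespace WheelOn

variable {a : V} {c : G.Walk a a}

theorem twoConnectedOn [Finite V] (h : G.WheelOn T v c) : G.TwoConnectedOn T := by
  have hcT : {z | z ∈ c.support} ⊆ T := fun z hz => (h.mem_iff z).2 (.inr hz)
  refine ⟨h.three_le.trans (Set.ncard_le_ncard (fun z hz => hcT hz.1) (Set.toFinite _)), ?_⟩
  intro w
  -- A neighbour of the hub that survives the deletion of `w`: the rest of the rim is connected, and
  -- the hub hangs on `t`.
  obtain ⟨t, ⟨htc, hvt⟩, htw⟩ : ∃ t ∈ {x | x ∈ c.support ∧ G.Adj v x}, t ∉ ({w} : Set V) := by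
    refine Set.exists_mem_notMem_of_ncard_lt_ncard ?_
    rw [Set.ncard_singleton]
    have := h.three_le
    omega
  have key : ∀ x ∈ T, x ≠ w → G.ReachableIn (T \ {w}) x t := by
    intro x hx hxw
    rcases (h.mem_iff x).1 hx with rfl | hxc
    · exact .of_adj ⟨hx, hxw⟩ ⟨hcT htc, htw⟩ hvt
    · exact (h.isCycle.reachableIn_sdiff_singleton hxc htc hxw htw).mono
        (Set.sdiff_subset_sdiff_left hcT)
  exact fun x hx y hy hxw hyw => (key x hx hxw).trans (key y hy hyw).symm

theorem not_hamiltonianOn (h : G.WheelOn T v c) (hG : G.CliqueFree 3) : ¬ G.HamiltonianOn T := by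
  rintro ⟨b, d, hd, hdT⟩
  obtain ⟨x, y, q, hq, hxy, hvx, hvy, hqs, -⟩ :=
    hd.exists_isPath_of_mem_support ((hdT v).2 ((h.mem_iff v).2 (.inl rfl)))
  have hqc : ∀ z, z ∈ q.support ↔ z ∈ c.support := by
    intro z
    rw [hqs, hdT, h.mem_iff]
    refine ⟨fun ⟨h1, h2⟩ => h1.resolve_left h2, fun hz => ⟨.inr hz, ?_⟩⟩
    rintro rfl
    exact h.notMem hz
  -- This is where triangle-freeness is essential: with `x` and `y` adjacent on the rim, the hub
  -- could be inserted between them. Being non-adjacent, they leave two non-empty rim arcs with no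
  -- edges between their interiors.
  have hnadj : ¬ G.Adj x y := hG.not_adj_of_adj_of_adj hvx hvy
  obtain ⟨p, r, hp, hr, -, hdis, hs, he⟩ := h.isCycle.exists_arcs ((hqc x).1 q.start_mem_support)
    ((hqc y).1 q.end_mem_support) hxy
  obtain ⟨m, hm, hm'⟩ := hp.exists_interior (p.two_le_length_of_not_adj hxy hnadj)
  obtain ⟨n, hn, hn'⟩ := hr.exists_interior (r.two_le_length_of_not_adj hxy hnadj)
  have hmq := (hqc m).2 ((hs m).2 (.inl hm))
  have hnq := (hqc n).2 ((hs n).2 (.inr hn))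
  have := (hq.reachableIn_interior hmq hnq hm' hn').mem_of_closed
    (K := {z | z ∈ p.support ∧ z ≠ x ∧ z ≠ y}) ⟨hm, hm'⟩ ?_
  · rcases hdis n this.1 hn with h | h
    exacts [hn'.1 h, hn'.2 h]
  · rintro s ⟨hsp, hsx, hsy⟩ t ⟨ht, htn⟩ hst
    refine ⟨?_, by simpa using htn⟩
    rcases (he _).1 (h.isChordless.mem_edges ((hs s).2 (.inl hsp)) ((hqc t).1 ht) hst) with h | h
    · exact p.snd_mem_support_of_mem_edges h
    · rcases hdis s hsp (r.fst_mem_support_of_mem_edges h) with h | h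
      exacts [absurd h hsx, absurd h hsy]

/-- If `S` contains the whole rim, it is the rim. Otherwise it lies in an induced path together with
the hub. -/
theorem hamiltonianOn_of_ssubset (h : G.WheelOn T v c) (hST : S ⊆ T) (hne : S ≠ T)
    (hS : G.TwoConnectedOn S) : G.HamiltonianOn S := by
  by_cases hc : ∀ w ∈ c.support, w ∈ S
  · refine ⟨a, c, h.isCycle, fun x => ⟨hc x, fun hx => ?_⟩⟩
    refine ((h.mem_iff x).1 (hST hx)).resolve_left ?_
    rintro rfl
    refine hne (hST.antisymm fun z hz => ?_)
    rcases (h.mem_iff z).1 hz with rfl | hz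
    exacts [hx, hc z hz]
  · push Not at hc
    obtain ⟨w, hw, hwS⟩ := hc
    obtain ⟨x, y, q, hq, -, -, -, hqs, hqe⟩ := h.isCycle.exists_isPath_of_mem_support hw
    refine hS.hamiltonianOn_of_subset_insert hq ?_ (v := v) (fun hv => h.notMem ((hqs v).1 hv).1) ?_
    · refine Walk.isChordless_iff_forall_mem_edges.2 fun s t hs ht hst => ?_
      have hs' := (hqs s).1 hs
      have ht' := (hqs t).1 ht
      refine hqe _ (h.isChordless.mem_edges hs'.1 ht'.1 hst) ?_
      rw [Sym2.mem_iff]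
      exact fun h => h.elim hs'.2.symm ht'.2.symm
    · intro z hz
      refine ((h.mem_iff z).1 (hST hz)).imp_right fun hzc => (hqs z).2 ⟨hzc, ?_⟩
      rintro rfl
      exact hwS hz

end WheelOn

/-! ### Finding thetas and wheels -/

/-- Some induced subgraph on a subset of `S` is a theta, a closed theta or a wheel. -/
def HasThreePathOrWheelIn (G : SimpleGraph V) (S : Set V) : Prop :=
  ∃ T ⊆ S, (∃ (u v : V) (P : Fin 3 → G.Walk u v), G.ThreePathOn T P) ∨
    ∃ (v a : V) (c : G.Walk a a), G.WheelOn T v c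

theorem HasThreePathOrWheelIn.mono (h : G.HasThreePathOrWheelIn S) (hST : S ⊆ T) :
    G.HasThreePathOrWheelIn T := by
  obtain ⟨R, hR, h⟩ := h
  exact ⟨R, hR.trans hST, h⟩

/-- Fix `x` and take a shortest walk avoiding `x` between two distinct neighbours of `x`. Minimality
makes it an induced path on which `x` has no further neighbours, so closing it through `x` creates
no chord. -/
theorem TwoConnectedOn.exists_chordless_cycle (hS : G.TwoConnectedOn S) :
    ∃ (a : V) (c : G.Walk a a), c.IsCycle ∧ c.IsChordless ∧ ∀ z ∈ c.support, z ∈ S := by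
  classical
  obtain ⟨x, hx⟩ : S.Nonempty := by
    refine Set.nonempty_of_ncard_ne_zero ?_
    have := hS.1
    omega
  have hex : ∃ n, ∃ (a b : V) (p : G.Walk a b), a ≠ b ∧ G.Adj x a ∧ G.Adj x b ∧
      (∀ z ∈ p.support, z ∈ S \ {x}) ∧ p.length = n := by
    obtain ⟨a, ha, b, hb, hab, hxa, hxb⟩ := hS.exists_pair_adj hx
    obtain ⟨p, hp⟩ := hS.2 x a ha b hb hxa.ne' hxb.ne'
    exact ⟨_, a, b, p, hab, hxa, hxb, hp, rfl⟩
  obtain ⟨a, b, p, hab, hxa, hxb, hpS, hn⟩ := Nat.find_spec hex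
  have hmin : ∀ (a b : V) (q : G.Walk a b), a ≠ b → G.Adj x a → G.Adj x b →
      (∀ z ∈ q.support, z ∈ S \ {x}) → p.length ≤ q.length := fun a b q h1 h2 h3 h4 =>
    hn ▸ Nat.find_min' hex ⟨a, b, q, h1, h2, h3, h4, rfl⟩
  obtain ⟨hp, hpc⟩ := Walk.isPath_and_isChordless_of_length_le (p := p) fun q hq =>
    hmin a b q hab hxa hxb fun z hz => hpS z (hq hz)
  have hxp : ∀ z ∈ p.support, z ≠ x := fun z hz => (hpS z hz).2
  have hnb : ∀ t ∈ p.support, G.Adj x t → t = a ∨ t = b := by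
    intro t ht hxt
    by_contra! hne
    have h1 := hmin a t (p.takeUntil t ht) hne.1.symm hxa hxt fun z hz =>
      hpS z (p.support_takeUntil_subset_support ht hz)
    have h2 := p.length_takeUntil_lt_length ht hne.2
    omega
  set q : G.Walk a b := .cons hxa.symm (.cons hxb .nil) with hq
  have hqs : ∀ z, z ∈ q.support ↔ z = a ∨ z = x ∨ z = b := fun z => by simp [hq]
  have hs : ∀ z, z ∈ (p.append q.reverse).support ↔ z ∈ p.support ∨ z = x := by
    intro z
    rw [Walk.mem_support_append_iff, Walk.support_reverse, List.mem_reverse, hqs]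
    constructor
    · rintro (h | rfl | rfl | rfl)
      exacts [.inl h, .inl p.start_mem_support, .inr rfl, .inl p.end_mem_support]
    · rintro (h | rfl)
      exacts [.inl h, .inr (.inr (.inl rfl))]
  have hxe : ∀ t ∈ p.support, G.Adj x t → s(x, t) ∈ (p.append q.reverse).edges := by
    intro t ht hxt
    rw [Walk.edges_append, List.mem_append, Walk.edges_reverse, List.mem_reverse]
    rcases hnb t ht hxt with rfl | rfl <;> simp [hq]
  refine ⟨a, p.append q.reverse, hp.isCycle_append_reverse ?_ ?_ (.inr (by simp [hq])), ?_, ?_⟩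
  · simp [hq, Walk.cons_isPath_iff, hab, hxa.ne', hxb.ne]
  · intro z hz hz'
    rcases (hqs z).1 hz' with h | h | h
    exacts [.inl h, absurd h (hxp z hz), .inr h]
  · refine Walk.isChordless_iff_forall_mem_edges.2 fun s t hs' ht' hst => ?_
    rcases (hs s).1 hs' with hsp | rfl <;> rcases (hs t).1 ht' with htp | rfl
    · rw [Walk.edges_append, List.mem_append]
      exact .inl (hpc.mem_edges hsp htp hst)
    · rw [Sym2.eq_swap]
      exact hxe s hsp hst.symm
    · exact hxe t htp hst
    · exact absurd rfl hst.ne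
  · intro z hz
    rcases (hs z).1 hz with h | rfl
    exacts [(hpS z h).1, hx]

theorem Walk.IsPath.exists_cons_concat {a b s t : V} {p : G.Walk s t} (hp : p.IsPath)
    (has : G.Adj a s) (htb : G.Adj t b) (ha : a ∉ p.support) (hb : b ∉ p.support) (hab : a ≠ b) :
    ∃ r : G.Walk a b, r.IsPath ∧ (∀ z, z ∈ r.support ↔ z = a ∨ z ∈ p.support ∨ z = b) ∧
      ∀ e, e ∈ r.edges ↔ e = s(a, s) ∨ e ∈ p.edges ∨ e = s(t, b) := by
  refine ⟨.cons has (p.concat htb), ?_, fun z => by simp [Walk.support_concat],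
    fun e => by simp [Walk.edges_concat]⟩
  rw [Walk.cons_isPath_iff, Walk.concat_isPath_iff, Walk.support_concat]
  refine ⟨⟨hp, hb⟩, fun h => ?_⟩
  rcases (by simpa using h : a ∈ p.support ∨ a = b) with h | h
  exacts [ha h, hab h]

/-- A path, whose ends and neighbours outside a chordless cycle `c` are two non-adjacent vertices
of `c`, forms a theta with `c`. -/
theorem hasThreePathOrWheelIn_of_theta {a b s t d : V} {c : G.Walk d d} (hc : c.IsCycle)
    (hcc : c.IsChordless) (hcS : ∀ z ∈ c.support, z ∈ S) (ha : a ∈ c.support)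
    (hb : b ∈ c.support) (hab : a ≠ b) (hnab : ¬ G.Adj a b) {p : G.Walk s t} (hp : p.IsPath)
    (hpc : p.IsChordless) (hpS : ∀ z ∈ p.support, z ∈ S ∧ z ∉ c.support) (has : G.Adj a s)
    (htb : G.Adj t b)
    (hatt : ∀ z ∈ p.support, ∀ r ∈ c.support, G.Adj z r → (z = s ∧ r = a) ∨ (z = t ∧ r = b)) :
    G.HasThreePathOrWheelIn S := by
  obtain ⟨q₁, q₂, hq₁, hq₂, -, hd, hs, he⟩ := hc.exists_arcs ha hb hab
  obtain ⟨r, hrp, hrs, hre⟩ := hp.exists_cons_concat has htb (fun h => (hpS a h).2 ha)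
    (fun h => (hpS b h).2 hb) hab
  have hdr : ∀ z, z ∈ c.support → z ∈ r.support → z = a ∨ z = b := by
    intro z hz hzr
    rcases (hrs z).1 hzr with h | h | h
    exacts [.inl h, absurd hz (hpS z h).2, .inr h]
  have hcross : ∀ z ∈ p.support, ∀ y ∈ c.support, G.Adj z y → s(z, y) ∈ r.edges := by
    intro z hz y hy hzy
    rw [hre]
    rcases hatt z hz y hy hzy with ⟨rfl, rfl⟩ | ⟨rfl, rfl⟩
    exacts [.inl Sym2.eq_swap, .inr (.inr rfl)]
  refine ⟨{z | z ∈ c.support ∨ z ∈ p.support}, ?_, .inl ⟨a, b, ![q₁, q₂, r], hab, ?_, ?_, ?_, ?_,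
    ?_⟩⟩
  · rintro z (hz | hz)
    exacts [hcS z hz, (hpS z hz).1]
  · intro i
    fin_cases i
    exacts [hq₁, hq₂, hrp]
  -- Non-adjacency of `a` and `b` alone makes all three paths long enough.
  · exact fun i => Walk.two_le_length_of_not_adj _ hab hnab
  · have h1 : ∀ z, z ∈ q₁.support → z ∈ c.support := fun z hz => (hs z).2 (.inl hz)
    have h2 : ∀ z, z ∈ q₂.support → z ∈ c.support := fun z hz => (hs z).2 (.inr hz)
    intro i j hij z hzi hzj
    fin_cases i <;> fin_cases j
    exacts [absurd rfl hij, hd z hzi hzj, hdr z (h1 z hzi) hzj, hd z hzj hzi, absurd rfl hij,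
      hdr z (h2 z hzi) hzj, hdr z (h1 z hzj) hzi, hdr z (h2 z hzj) hzi, absurd rfl hij]
  · intro z
    rw [Fin.exists_fin_succ, Fin.exists_fin_two]
    change (z ∈ c.support ∨ z ∈ p.support) ↔ z ∈ q₁.support ∨ z ∈ q₂.support ∨ z ∈ r.support
    rw [hs, hrs]
    constructor
    · rintro ((h | h) | h)
      exacts [.inl h, .inr (.inl h), .inr (.inr (.inr (.inl h)))]
    · rintro (h | h | rfl | h | rfl)
      exacts [.inl (.inl h), .inl (.inr h), .inl (.inl q₁.start_mem_support), .inr h,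
        .inl (.inl q₁.end_mem_support)]
  · intro x hx y hy hxy
    left
    rcases hx with hx | hx <;> rcases hy with hy | hy
    · rcases (he _).1 (hcc.mem_edges hx hy hxy) with h | h
      exacts [⟨0, h⟩, ⟨1, h⟩]
    · exact ⟨2, by rw [Sym2.eq_swap]; exact hcross y hy x hx hxy.symm⟩
    · exact ⟨2, hcross x hx y hy hxy⟩
    · exact ⟨2, (hre _).2 (.inr (.inl (hpc.mem_edges hx hy hxy)))⟩

/-- A path between two non-adjacent vertices of a chordless cycle `c` with a common neighbour `h`
in `c`, such that all other edges between the path and `c` end in `h` and there are such edges,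
forms a wheel with `c - h`. -/
theorem hasThreePathOrWheelIn_of_hub {a b s t d h m : V} {c : G.Walk d d} (hc : c.IsCycle)
    (hcc : c.IsChordless) (hcS : ∀ z ∈ c.support, z ∈ S) (ha : a ∈ c.support)
    (hb : b ∈ c.support) (hab : a ≠ b) (hnab : ¬ G.Adj a b) {p : G.Walk s t} (hp : p.IsPath)
    (hpc : p.IsChordless) (hpS : ∀ z ∈ p.support, z ∈ S ∧ z ∉ c.support) (has : G.Adj a s)
    (htb : G.Adj t b) (hh : h ∈ c.support) (hha : G.Adj h a) (hhb : G.Adj h b)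
    (hm : m ∈ p.support) (hhm : G.Adj h m)
    (hatt : ∀ z ∈ p.support, ∀ r ∈ c.support, G.Adj z r →
      (z = s ∧ r = a) ∨ (z = t ∧ r = b) ∨ r = h) :
    G.HasThreePathOrWheelIn S := by
  -- `q` is the arc of `c` that avoids `h`. It is induced because an edge of `c` within it that
  -- belongs to the other arc would have to join `a` and `b`.
  obtain ⟨q, hq, hl, hqc, hhq, hqe⟩ : ∃ q : G.Walk a b, q.IsPath ∧ 2 ≤ q.length ∧
      (∀ z ∈ q.support, z ∈ c.support) ∧ h ∉ q.support ∧
      ∀ x ∈ q.support, ∀ y ∈ q.support, G.Adj x y → s(x, y) ∈ q.edges := by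
    have key : ∀ q q' : G.Walk a b, q.IsPath →
        (∀ z, z ∈ q.support → z ∈ q'.support → z = a ∨ z = b) →
        (∀ z ∈ q.support, z ∈ c.support) → (∀ e ∈ c.edges, e ∈ q.edges ∨ e ∈ q'.edges) →
        h ∈ q'.support → ∃ q : G.Walk a b, q.IsPath ∧ 2 ≤ q.length ∧
        (∀ z ∈ q.support, z ∈ c.support) ∧ h ∉ q.support ∧
        ∀ x ∈ q.support, ∀ y ∈ q.support, G.Adj x y → s(x, y) ∈ q.edges := by
      intro q q' hq hd hqc he hh
      refine ⟨q, hq, q.two_le_length_of_not_adj hab hnab, hqc, fun hhq => ?_,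
        fun x hx y hy hxy => ?_⟩
      · rcases hd h hhq hh with rfl | rfl
        exacts [hha.ne rfl, hhb.ne rfl]
      · refine (he _ (hcc.mem_edges (hqc x hx) (hqc y hy) hxy)).resolve_right fun hxy' => ?_
        rcases hd x hx (q'.fst_mem_support_of_mem_edges hxy') with rfl | rfl <;>
          rcases hd y hy (q'.snd_mem_support_of_mem_edges hxy') with rfl | rfl
        exacts [hxy.ne rfl, hnab hxy, hnab hxy.symm, hxy.ne rfl]
    obtain ⟨q₁, q₂, hq₁, hq₂, -, hd, hs, he⟩ := hc.exists_arcs ha hb hab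
    rcases (hs h).1 hh with h1 | h2
    · exact key q₂ q₁ hq₂ (fun z h1 h2 => hd z h2 h1) (fun z hz => (hs z).2 (.inr hz))
        (fun e h => ((he e).1 h).symm) h1
    · exact key q₁ q₂ hq₁ hd (fun z hz => (hs z).2 (.inl hz)) (fun e h => (he e).1 h) h2
  obtain ⟨r, hrp, hrs, hre⟩ := hp.exists_cons_concat has htb (fun h => (hpS a h).2 ha)
    (fun h => (hpS b h).2 hb) hab
  have hcyc : (q.append r.reverse).IsCycle := by
    refine hq.isCycle_append_reverse hrp (fun z hz hzr => ?_) (.inl hl)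
    rcases (hrs z).1 hzr with h | h | h
    exacts [.inl h, absurd (hqc z hz) (hpS z h).2, .inr h]
  have hs : ∀ z, z ∈ (q.append r.reverse).support ↔ z ∈ q.support ∨ z ∈ p.support := by
    intro z
    rw [Walk.mem_support_append_iff, Walk.support_reverse, List.mem_reverse, hrs]
    constructor
    · rintro (h | rfl | h | rfl)
      exacts [.inl h, .inl q.start_mem_support, .inr h, .inl q.end_mem_support]
    · rintro (h | h)
      exacts [.inl h, .inr (.inr (.inl h))]
  have he : ∀ e, e ∈ (q.append r.reverse).edges ↔ e ∈ q.edges ∨ e ∈ r.edges := by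
    intro e
    rw [Walk.edges_append, List.mem_append, Walk.edges_reverse, List.mem_reverse]
  have hcross : ∀ z ∈ p.support, ∀ y ∈ q.support, G.Adj z y → s(z, y) ∈ r.edges := by
    intro z hz y hy hzy
    rw [hre]
    rcases hatt z hz y (hqc y hy) hzy with ⟨rfl, rfl⟩ | ⟨rfl, rfl⟩ | rfl
    exacts [.inl Sym2.eq_swap, .inr (.inr rfl), absurd hy hhq]
  refine ⟨{z | z = h ∨ z ∈ (q.append r.reverse).support}, ?_,
    .inr ⟨h, a, q.append r.reverse, hcyc, ?_, ?_, fun _ => Iff.rfl, ?_⟩⟩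
  · rintro z (rfl | hz)
    · exact hcS z hh
    · rcases (hs z).1 hz with hz | hz
      exacts [hcS z (hqc z hz), (hpS z hz).1]
  · refine Walk.isChordless_iff_forall_mem_edges.2 fun x y hx hy hxy => (he _).2 ?_
    rcases (hs x).1 hx with hx | hx <;> rcases (hs y).1 hy with hy | hy
    · exact .inl (hqe x hx y hy hxy)
    · exact .inr (by rw [Sym2.eq_swap]; exact hcross y hy x hx hxy.symm)
    · exact .inr (hcross x hx y hy hxy)
    · exact .inr ((hre _).2 (.inr (.inl (hpc.mem_edges hx hy hxy))))
  · rw [hs]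
    rintro (h' | h')
    exacts [hhq h', (hpS h h').2 hh]
  · have hfin : {x | x ∈ (q.append r.reverse).support ∧ G.Adj h x}.Finite :=
      (List.finite_toSet (q.append r.reverse).support).subset fun x hx => hx.1
    refine (Set.two_lt_ncard hfin).2 ⟨a, ⟨(hs a).2 (.inl q.start_mem_support), hha⟩,
      b, ⟨(hs b).2 (.inl q.end_mem_support), hhb⟩, m, ⟨(hs m).2 (.inr hm), hhm⟩, hab, ?_, ?_⟩
    · rintro rfl
      exact (hpS a hm).2 ha
    · rintro rfl
      exact (hpS b hm).2 hb

/-- If two non-adjacent vertices of a chordless cycle `c` are joined by a path outside `c`, then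
there is a theta or a wheel. -/
theorem hasThreePathOrWheelIn_of_attachments (hG : G.CliqueFree 3) {a b s t d : V}
    {c : G.Walk d d} (hc : c.IsCycle) (hcc : c.IsChordless) (hcS : ∀ z ∈ c.support, z ∈ S)
    (ha : a ∈ c.support) (hb : b ∈ c.support) (hab : a ≠ b) (hnab : ¬ G.Adj a b)
    (has : G.Adj a s) (htb : G.Adj t b)
    (hst : G.ReachableIn {z | z ∈ S ∧ z ∉ c.support} s t) : G.HasThreePathOrWheelIn S := by
  classical
  -- The length is minimised over all pairs of non-adjacent attachments at once, not only over paths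
  -- for the given pair.
  have hex : ∃ n, ∃ (a b s t : V) (p : G.Walk s t), a ∈ c.support ∧ b ∈ c.support ∧ a ≠ b ∧
      ¬ G.Adj a b ∧ G.Adj a s ∧ G.Adj t b ∧ (∀ z ∈ p.support, z ∈ S ∧ z ∉ c.support) ∧
      p.length = n := by
    obtain ⟨p, hp⟩ := hst
    exact ⟨_, a, b, s, t, p, ha, hb, hab, hnab, has, htb, hp, rfl⟩
  clear ha hb hab hnab has htb hst a b s t
  obtain ⟨a, b, s, t, p, ha, hb, hab, hnab, has, htb, hpS, hn⟩ := Nat.find_spec hex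
  have hmin : ∀ (a b s t : V) (q : G.Walk s t), a ∈ c.support → b ∈ c.support → a ≠ b →
      ¬ G.Adj a b → G.Adj a s → G.Adj t b → q.support ⊆ p.support → p.length ≤ q.length :=
    fun a b s t q h1 h2 h3 h4 h5 h6 h7 =>
      hn ▸ Nat.find_min' hex ⟨a, b, s, t, q, h1, h2, h3, h4, h5, h6, fun z hz => hpS z (h7 hz), rfl⟩
  obtain ⟨hp, hpc⟩ := Walk.isPath_and_isChordless_of_length_le (p := p) fun q hq =>
    hmin a b s t q ha hb hab hnab has htb hq
  -- If `z` sees a vertex `r` of `c` distinct from and not adjacent to `a`, then the part of `p` up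
  -- to `z` joins `a` to `r` and is shorter. `right` is the mirror image.
  have left : ∀ z ∈ p.support, ∀ r ∈ c.support, G.Adj z r → z ≠ t → r = a ∨ G.Adj a r := by
    intro z hz r hr hzr hzt
    by_contra! hne
    have h1 := hmin a r s z (p.takeUntil z hz) ha hr hne.1.symm hne.2 has hzr
      (p.support_takeUntil_subset_support hz)
    have h2 := p.length_takeUntil_lt_length hz hzt
    omega
  have right : ∀ z ∈ p.support, ∀ r ∈ c.support, G.Adj z r → z ≠ s → r = b ∨ G.Adj r b := by
    intro z hz r hr hzr hzs
    by_contra! hne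
    have h1 := hmin r b z t (p.dropUntil z hz) hr hb hne.1 hne.2 hzr.symm htb
      (p.support_dropUntil_subset_support hz)
    have h2 := p.length_dropUntil_lt_length hz hzs
    omega
  by_cases hst : s = t
  · subst hst
    obtain rfl : p = .nil := by simpa using hp
    by_cases h3 : 3 ≤ {x | x ∈ c.support ∧ G.Adj s x}.ncard
    · refine ⟨{z | z = s ∨ z ∈ c.support}, ?_, .inr ⟨s, d, c, hc, hcc, (hpS s (by simp)).2,
        fun _ => Iff.rfl, h3⟩⟩
      rintro z (rfl | hz)
      exacts [(hpS z (by simp)).1, hcS z hz]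
    · refine hasThreePathOrWheelIn_of_theta hc hcc hcS ha hb hab hnab hp hpc hpS has htb ?_
      intro z hz r hr hzr
      obtain rfl : z = s := by simpa using hz
      by_contra! hne
      have hra : r ≠ a := hne.1 rfl
      have hrb : r ≠ b := hne.2 rfl
      have hfin : {x | x ∈ c.support ∧ G.Adj z x}.Finite :=
        (List.finite_toSet c.support).subset fun x hx => hx.1
      exact h3 ((Set.two_lt_ncard hfin).2
        ⟨a, ⟨ha, has.symm⟩, b, ⟨hb, htb⟩, r, ⟨hr, hzr⟩, hab, hra.symm, hrb.symm⟩)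
  -- At the ends of `p`, triangle-freeness leaves only `a` and `b`; from inner vertices of `p` only
  -- common neighbours of `a` and `b` can be seen.
  have hatt : ∀ z ∈ p.support, ∀ r ∈ c.support, G.Adj z r → (z = s ∧ r = a) ∨ (z = t ∧ r = b) ∨
      (G.Adj r a ∧ G.Adj r b ∧ z ≠ s ∧ z ≠ t) := by
    intro z hz r hr hzr
    by_cases hzs : z = s
    · subst hzs
      refine .inl ⟨rfl, (left z hz r hr hzr hst).resolve_right ?_⟩
      exact hG.not_adj_of_adj_of_adj has.symm hzr
    by_cases hzt : z = t
    · subst hzt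
      refine .inr (.inl ⟨rfl, (right z hz r hr hzr hzs).resolve_right ?_⟩)
      exact hG.not_adj_of_adj_of_adj hzr htb
    rcases left z hz r hr hzr hzt with rfl | h1 <;> rcases right z hz r hr hzr hzs with rfl | h2
    exacts [absurd rfl hab, absurd h2 hnab, absurd h1 hnab, .inr (.inr ⟨h1.symm, h2, hzs, hzt⟩)]
  by_cases hub : ∃ m ∈ p.support, ∃ h ∈ c.support, G.Adj m h ∧ G.Adj h a ∧ G.Adj h b ∧
      m ≠ s ∧ m ≠ t
  · obtain ⟨m, hm, h, hh, hmh, hha, hhb, hms, hmt⟩ := hub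
    refine hasThreePathOrWheelIn_of_hub hc hcc hcS ha hb hab hnab hp hpc hpS has htb hh hha hhb hm
      hmh.symm fun z hz r hr hzr => ?_
    refine (hatt z hz r hr hzr).imp_right fun h' => h'.imp_right ?_
    rintro ⟨hra, hrb, hzs, hzt⟩
    by_contra hrh
    -- Two such common neighbours `r` and `h` are non-adjacent, as both see `a`. The part of `p`
    -- between `z` and `m` would join them and be shorter than `p`, so the hub is unique.
    have hnrh : ¬ G.Adj r h := hG.not_adj_of_adj_of_adj hra.symm hha.symm
    by_cases hzm : z ∈ (p.dropUntil m hm).support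
    · have h1 := hmin h r m z ((p.dropUntil m hm).takeUntil z hzm) hh hr (Ne.symm hrh)
        (fun h => hnrh h.symm) hmh.symm hzr
        (List.Subset.trans ((p.dropUntil m hm).support_takeUntil_subset_support hzm)
          (p.support_dropUntil_subset_support hm))
      have h2 := (p.dropUntil m hm).length_takeUntil_le_length hzm
      have h3 := p.length_dropUntil_lt_length hm hms
      omega
    · have hzm' : z ∈ (p.takeUntil m hm).support := by
        rw [← p.take_spec hm, Walk.mem_support_append_iff] at hz
        exact hz.resolve_right hzm
      have h1 := hmin r h z m ((p.takeUntil m hm).dropUntil z hzm') hr hh hrh hnrh hzr.symm hmh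
        (List.Subset.trans ((p.takeUntil m hm).support_dropUntil_subset_support hzm')
          (p.support_takeUntil_subset_support hm))
      have h2 := (p.takeUntil m hm).length_dropUntil_le_length hzm'
      have h3 := p.length_takeUntil_lt_length hm hmt
      omega
  · refine hasThreePathOrWheelIn_of_theta hc hcc hcS ha hb hab hnab hp hpc hpS has htb ?_
    intro z hz r hr hzr
    rcases hatt z hz r hr hzr with h | h | ⟨h1, h2, h3, h4⟩
    exacts [.inl h, .inr h, absurd ⟨z, hz, r, hr, hzr, h1, h2, h3, h4⟩ hub]

/-! ### Edge cutsets and Hamiltonian cycles -/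

/-- If `xy` is an edge and the other vertices of `S` fall into at least three components after the
deletion of `x` and `y`, there is a closed theta. -/
theorem TwoConnectedOn.hasThreePathOrWheelIn (hS : G.TwoConnectedOn S) (hx : x ∈ S) (hy : y ∈ S)
    (hxy : G.Adj x y) (m : Fin 3 → V) (hm : ∀ i, m i ∈ S \ {x, y})
    (hmm : ∀ i j, i ≠ j → ¬ G.ReachableIn (S \ {x, y}) (m i) (m j)) :
    G.HasThreePathOrWheelIn S := by
  have hdel : ∀ {K : Set V} {a b : V}, x ∉ K → G.ReachableIn K a b →
      (G.deleteEdges {s(x, y)}).ReachableIn K a b := by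
    rintro K a b hxK ⟨p, hp⟩
    refine ⟨p.toDeleteEdges {s(x, y)} fun e he hxe => ?_, by simpa using hp⟩
    rw [Set.mem_singleton_iff] at hxe
    subst hxe
    exact hxK (hp x (p.fst_mem_support_of_mem_edges he))
  have hpath : ∀ i, ∃ p : G.Walk x y, p.IsPath ∧ 2 ≤ p.length ∧
      (∀ z ∈ p.support, z = x ∨ z = y ∨ G.ReachableIn (S \ {x, y}) (m i) z) ∧
      ∀ s ∈ p.support, ∀ t ∈ p.support, G.Adj s t → s(s, t) ∈ p.edges ∨ s(s, t) = s(x, y) := by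
    intro i
    set C : Set V := {z | G.ReachableIn (S \ {x, y}) (m i) z} with hC
    have hmC : m i ∈ C := .refl (hm i)
    have hCS : C ⊆ S \ {x, y} := fun z hz => ReachableIn.right_mem hz
    -- Each of `x`, `y` has a neighbour in the component `C`, since deleting the other one leaves
    -- `S` connected.
    have nbr : ∀ x' y', ({x', y'} : Set V) = {x, y} → x' ∈ S → x' ≠ y' → ∃ a ∈ C, G.Adj a x' := by
      intro x' y' he hx' hne
      have hmi := hm i
      rw [← he] at hmi
      have h1 : m i ≠ y' := fun h => hmi.2 (by simp [h])
      obtain ⟨a, -, b, hb, haC, hbC, hab⟩ :=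
        (hS.2 y' (m i) hmi.1 x' hx' h1 hne).exists_adj_boundary (K := C) hmC
          (fun h => (hCS h).2 (by rw [← he]; simp))
      obtain rfl : b = x' := by
        by_contra hbx
        have hbS : b ∈ S \ {x, y} := by
          rw [← he]
          exact ⟨hb.1, by simp [hbx, show b ≠ y' from hb.2]⟩
        exact hbC (ReachableIn.trans haC (.of_adj (hCS haC) hbS hab))
      exact ⟨a, haC, hab⟩
    obtain ⟨a, ha, hax⟩ := nbr x y rfl hx hxy.ne
    obtain ⟨b, hb, hby⟩ := nbr y x (Set.pair_comm y x) hy hxy.ne'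
    have hne : ∀ z ∈ C, z ≠ x ∧ z ≠ y := fun z hz => by simpa using (hCS hz).2
    have hCC : G.ReachableIn C a b := by
      have hin : ∀ z ∈ C, G.ReachableIn C (m i) z := by
        rintro z ⟨p, hp⟩
        classical
        refine ⟨p, fun w hw => ⟨p.takeUntil w hw, fun t ht => ?_⟩⟩
        exact hp t (p.support_takeUntil_subset_support hw ht)
      exact (hin a ha).symm.trans (hin b hb)
    have hadj : ∀ {s t}, G.Adj s t → s(s, t) ≠ s(x, y) → (G.deleteEdges {s(x, y)}).Adj s t :=
      fun h h' => (deleteEdges_adj).2 ⟨h, by simpa using h'⟩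
    have hx' : x ∈ insert x (insert y C) := by simp
    have hy' : y ∈ insert x (insert y C) := by simp
    have hCi : C ⊆ insert x (insert y C) := fun z hz => by simp [hz]
    -- The edge `xy` is removed before an induced path is chosen; otherwise that path could be the
    -- edge itself.
    have hr : (G.deleteEdges {s(x, y)}).ReachableIn (insert x (insert y C)) x y := by
      refine ((ReachableIn.of_adj hx' (hCi ha) (hadj hax.symm ?_)).trans
        ((hdel (fun h => (hne x h).1 rfl) hCC).mono hCi)).trans
        (.of_adj (hCi hb) hy' (hadj hby ?_))
      · intro h
        rcases Sym2.eq_iff.1 h with h | h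
        exacts [(hne a ha).2 h.2, (hne a ha).1 h.2]
      · intro h
        rcases Sym2.eq_iff.1 h with h | h
        exacts [(hne b hb).1 h.1, (hne b hb).2 h.1]
    obtain ⟨p, hp, hpc, hps⟩ := hr.exists_isPath_isChordless
    have hl : 2 ≤ p.length := p.two_le_length_of_not_adj hxy.ne (by simp [deleteEdges_adj])
    have hle : G.deleteEdges {s(x, y)} ≤ G := deleteEdges_le _
    refine ⟨p.mapLe hle, hp.mapLe hle, by simpa using hl, fun z hz => ?_, fun s hs t ht hst => ?_⟩
    · rw [Walk.support_mapLe_eq_support] at hz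
      exact hps z hz
    · rw [Walk.support_mapLe_eq_support] at hs ht
      rw [Walk.edges_mapLe_eq_edges]
      by_cases h : s(s, t) = s(x, y)
      exacts [.inr h, .inl (hpc.mem_edges hs ht (hadj hst h))]
  choose P hP hl hs he using hpath
  have hC : ∀ i, ∀ z, G.ReachableIn (S \ {x, y}) (m i) z → z ∈ S ∧ z ≠ x ∧ z ≠ y := fun i z h => by
    simpa using h.right_mem
  refine ⟨{z | ∃ i, z ∈ (P i).support}, ?_, .inl ⟨x, y, P, hxy.ne, hP, hl, ?_, fun _ => Iff.rfl, ?_⟩⟩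
  · rintro z ⟨i, hz⟩
    rcases hs i z hz with rfl | rfl | h
    exacts [hx, hy, (hC i z h).1]
  · intro i j hij z hzi hzj
    rcases hs i z hzi with h | h | h
    · exact .inl h
    · exact .inr h
    · rcases hs j z hzj with h' | h' | h'
      exacts [.inl h', .inr h', absurd (h.trans h'.symm) (hmm i j hij)]
  · rintro s ⟨i, hsi⟩ t ⟨j, htj⟩ hst
    have same : ∀ i, s ∈ (P i).support → t ∈ (P i).support →
        (∃ i, s(s, t) ∈ (P i).edges) ∨ s(s, t) = s(x, y) := fun i hs ht =>
      (he i s hs t ht hst).imp_left fun h => ⟨i, h⟩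
    rcases hs i s hsi with rfl | rfl | h
    · exact same j (P j).start_mem_support htj
    · exact same j (P j).end_mem_support htj
    · rcases hs j t htj with rfl | rfl | h'
      · exact same i hsi (P i).start_mem_support
      · exact same i hsi (P i).end_mem_support
      · obtain rfl : i = j := by
          by_contra hij
          exact hmm i j hij ((h.trans (.of_adj h.right_mem h'.right_mem hst)).trans h'.symm)
        exact same i hsi htj

/-- A 2-connected triangle-free graph without induced thetas and wheels that is not a chordless
cycle is disconnected by the deletion of two adjacent vertices. -/
theorem TwoConnectedOn.exists_edge_cutset (hG : G.CliqueFree 3) (hS : G.TwoConnectedOn S)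
    (hno : ¬ G.HasThreePathOrWheelIn S) {d : V} {c : G.Walk d d} (hc : c.IsCycle)
    (hcc : c.IsChordless) (hcS : ∀ z ∈ c.support, z ∈ S) (hz : z ∈ S) (hzc : z ∉ c.support) :
    ∃ x ∈ S, ∃ y ∈ S, G.Adj x y ∧ ∃ z ∈ S \ {x, y}, ∃ t ∈ S \ {x, y},
      ¬ G.ReachableIn (S \ {x, y}) z t := by
  set R : Set V := {w | w ∈ S ∧ w ∉ c.support} with hR
  have hzR : z ∈ R := ⟨hz, hzc⟩
  have third : ∀ w ∈ c.support, ∀ w', ∃ t ∈ c.support, t ≠ w ∧ t ≠ w' := by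
    intro w hw w'
    obtain ⟨x, y, q, -, hxy, -, -, hqs, -⟩ := hc.exists_isPath_of_mem_support hw
    have hx := (hqs x).1 q.start_mem_support
    have hy := (hqs y).1 q.end_mem_support
    by_cases h : x = w'
    · exact ⟨y, hy.1, hy.2, fun h' => hxy (h.trans h'.symm)⟩
    · exact ⟨x, hx.1, hx.2, h⟩
  -- As `S` stays connected without `w`, the component of `z` outside `c` is attached to `c` at some
  -- vertex other than `w`. Used twice, this gives two attachments.
  have attach : ∀ w ∈ c.support, ∃ r ∈ c.support, r ≠ w ∧ ∃ s, G.ReachableIn R z s ∧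
      G.Adj s r := by
    intro w hw
    obtain ⟨t, ht, htw, -⟩ := third w hw w
    have hzw : z ≠ w := by
      rintro rfl
      exact hzc hw
    obtain ⟨s, -, r, hr, hs, hrn, hsr⟩ :=
      (hS.2 w z hz t (hcS t ht) hzw htw).exists_adj_boundary
        (K := {s | G.ReachableIn R z s}) (.refl hzR) (fun h => h.right_mem.2 ht)
    refine ⟨r, ?_, hr.2, s, hs, hsr⟩
    by_contra hrc
    exact hrn (hs.trans (.of_adj hs.right_mem ⟨hr.1, hrc⟩ hsr))
  have clique : ∀ a ∈ c.support, ∀ b ∈ c.support, a ≠ b → ∀ s t, G.ReachableIn R z s →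
      G.ReachableIn R z t → G.Adj s a → G.Adj t b → G.Adj a b := by
    intro a ha b hb hab s t hs ht hsa htb
    by_contra hnab
    exact hno (hasThreePathOrWheelIn_of_attachments hG hc hcc hcS ha hb hab hnab hsa.symm htb
      (hs.symm.trans ht))
  obtain ⟨x, hx, -, s, hs, hsx⟩ := attach d c.start_mem_support
  obtain ⟨y, hy, hyx, t, ht, hty⟩ := attach x hx
  have hxy : G.Adj x y := clique x hx y hy hyx.symm s t hs ht hsx hty
  obtain ⟨r, hr, hrx, hry⟩ := third x hx y
  refine ⟨x, hcS x hx, y, hcS y hy, hxy, z, ⟨hz, ?_⟩, r, ⟨hcS r hr, by simp [hrx, hry]⟩,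
    fun hzr => ?_⟩
  · rw [Set.mem_insert_iff, Set.mem_singleton_iff]
    rintro (rfl | rfl)
    exacts [hzc hx, hzc hy]
  · refine (hzr.mem_of_closed (K := {s | G.ReachableIn R z s}) (.refl hzR) ?_).right_mem.2 hr
    rintro a ha b ⟨hbS, hbn⟩ hab
    simp only [Set.mem_insert_iff, Set.mem_singleton_iff, not_or] at hbn
    by_cases hbc : b ∈ c.support
    -- A third attachment `b` would form a triangle with `x` and `y`.
    · exact absurd hxy (hG.not_adj_of_adj_of_adj
        (clique b hbc x hx hbn.1 a s ha hs hab hsx) (clique b hbc y hy hbn.2 a t ha ht hab hty))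
    · exact ReachableIn.trans ha (.of_adj ha.right_mem ⟨hbS, hbc⟩ hab)

/-- Deleting a part of the graph that is attached at the ends of an edge preserves
connectivity. -/
theorem ReachableIn.of_boundary_subset {X : Set V} {a b : V} (h : G.ReachableIn (S \ X) a b)
    (hxy : G.Adj x y) (hx : x ∈ T) (hy : y ∈ T)
    (hT : ∀ a ∈ T, ∀ b ∈ S, b ∉ T → G.Adj a b → a = x ∨ a = y) (ha : a ∈ T) (hb : b ∈ T) :
    G.ReachableIn (T \ X) a b := by
  obtain ⟨p, hp⟩ := h
  -- Excursions of the walk outside `T` leave and return through `x` or `y`, and the edge `xy`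
  -- replaces them. For a walk starting outside `T`, `e` is its first vertex in `T`.
  suffices (a ∈ T → G.ReachableIn (T \ X) a b) ∧
      (a ∉ T → ∃ e, (e = x ∨ e = y) ∧ e ∉ X ∧ G.ReachableIn (T \ X) e b) from this.1 ha
  clear ha
  induction p with
  | nil => exact ⟨fun h => .refl ⟨h, (hp _ (by simp)).2⟩, fun h => absurd hb h⟩
  | @cons a a' b hadj p ih =>
    have haS := hp a (by simp)
    have ha'S := hp a' (by simp)
    obtain ⟨ih1, ih2⟩ := ih hb fun z hz => hp z (by simp [hz])
    have step : ∀ {a c : V}, a ∈ T → a ∉ X → c ∈ T → c ∉ X → G.Adj a c →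
        G.ReachableIn (T \ X) a c := fun h1 h2 h3 h4 h => .of_adj ⟨h1, h2⟩ ⟨h3, h4⟩ h
    by_cases ha' : a' ∈ T
    · refine ⟨fun ha => (step ha haS.2 ha' ha'S.2 hadj).trans (ih1 ha'),
        fun ha => ⟨a', hT a' ha' a haS.1 ha hadj.symm, ha'S.2, ih1 ha'⟩⟩
    · obtain ⟨e, he, heX, hr⟩ := ih2 ha'
      refine ⟨fun ha => ?_, fun _ => ⟨e, he, heX, hr⟩⟩
      rcases hT a ha a' ha'S.1 ha' hadj with rfl | rfl <;> rcases he with rfl | rfl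
      · exact hr
      · exact (step ha haS.2 hy heX hxy).trans hr
      · exact (step ha haS.2 hx heX hxy.symm).trans hr
      · exact hr

/-- A 2-connected triangle-free graph without induced thetas, closed thetas and wheels has a
Hamiltonian cycle through all edges whose ends do not disconnect the graph. -/
theorem TwoConnectedOn.exists_cycle [Finite V] (hG : G.CliqueFree 3) (hS : G.TwoConnectedOn S)
    (hno : ¬ G.HasThreePathOrWheelIn S) :
    ∃ (a : V) (c : G.Walk a a), c.IsCycle ∧ (∀ z, z ∈ c.support ↔ z ∈ S) ∧
      ∀ u ∈ S, ∀ v ∈ S, G.Adj u v →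
        (∀ s ∈ S \ {u, v}, ∀ t ∈ S \ {u, v}, G.ReachableIn (S \ {u, v}) s t) →
        s(u, v) ∈ c.edges := by
  induction hn : S.ncard using Nat.strong_induction_on generalizing S with
  | _ n ih =>
    subst hn
    obtain ⟨d, c, hc, hcc, hcS⟩ := hS.exists_chordless_cycle
    by_cases hSc : ∀ z ∈ S, z ∈ c.support
    · exact ⟨d, c, hc, fun z => ⟨hcS z, hSc z⟩, fun u hu v hv huv _ =>
        hcc.mem_edges (hSc u hu) (hSc v hv) huv⟩
    push Not at hSc
    obtain ⟨z, hz, hzc⟩ := hSc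
    obtain ⟨x, hx, y, hy, hxy, z, hz, t, ht, hzt⟩ :=
      hS.exists_edge_cutset hG hno hc hcc hcS hz hzc
    -- One side of the cutset: the component of `z` together with `x` and `y`. It is smaller because
    -- it misses `t`, and `of_boundary_subset` passes connectivity down to it.
    have side : ∀ z ∈ S \ {x, y}, ∀ t ∈ S \ {x, y}, ¬ G.ReachableIn (S \ {x, y}) z t →
        ∃ p : G.Walk x y, p.IsPath ∧ 1 < p.length ∧
          (∀ w, w ∈ p.support ↔ w = x ∨ w = y ∨ G.ReachableIn (S \ {x, y}) z w) ∧
          ∀ u ∈ p.support, ∀ v ∈ p.support, G.Adj u v →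
            (∀ s ∈ S \ {u, v}, ∀ t ∈ S \ {u, v}, G.ReachableIn (S \ {u, v}) s t) →
            s(u, v) = s(x, y) ∨ s(u, v) ∈ p.edges := by
      intro z hz t ht hzt
      set S' : Set V := {w | w = x ∨ w = y ∨ G.ReachableIn (S \ {x, y}) z w} with hS'
      have hxS' : x ∈ S' := .inl rfl
      have hyS' : y ∈ S' := .inr (.inl rfl)
      have hzS' : z ∈ S' := .inr (.inr (.refl hz))
      have hsub : S' ⊆ S := by
        rintro w (rfl | rfl | h)
        exacts [hx, hy, h.right_mem.1]
      have htS' : t ∉ S' := by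
        rintro (rfl | rfl | h)
        exacts [ht.2 (by simp), ht.2 (by simp), hzt h]
      have hbd : ∀ a ∈ S', ∀ b ∈ S, b ∉ S' → G.Adj a b → a = x ∨ a = y := by
        rintro a (ha | ha | ha) b hb hbS' hab
        · exact .inl ha
        · exact .inr ha
        · refine absurd (.inr (.inr (ha.trans (.of_adj ha.right_mem ⟨hb, ?_⟩ hab)))) hbS'
          rintro (rfl | rfl)
          exacts [hbS' hxS', hbS' hyS']
      have hproj : ∀ {X : Set V} {a b : V}, a ∈ S' → b ∈ S' → G.ReachableIn (S \ X) a b →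
          G.ReachableIn (S' \ X) a b := fun ha hb h =>
        h.of_boundary_subset hxy hxS' hyS' hbd ha hb
      have hzxy : z ≠ x ∧ z ≠ y := by simpa using hz.2
      have htc : G.TwoConnectedOn S' := by
        refine ⟨(Set.two_lt_ncard (Set.toFinite _)).2 ⟨x, hxS', y, hyS', z, hzS', hxy.ne,
          hzxy.1.symm, hzxy.2.symm⟩, fun w a ha b hb haw hbw => ?_⟩
        exact hproj ha hb (hS.2 w a (hsub ha) b (hsub hb) haw hbw)
      have hlt : S'.ncard < S.ncard :=
        Set.ncard_lt_ncard (Set.ssubset_iff_subset_ne.2 ⟨hsub, fun h => htS' (h ▸ ht.1)⟩)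
          (Set.toFinite _)
      obtain ⟨a, c, hc, hcs, hce⟩ := ih _ hlt htc (fun h => hno (h.mono hsub)) rfl
      -- Within the side, deleting `x` and `y` leaves just the component of `z`, which is connected.
      -- So the strengthened induction hypothesis puts `xy` on the cycle.
      have hxyc : s(x, y) ∈ c.edges := by
        have hreach : ∀ s ∈ S' \ {x, y}, G.ReachableIn (S \ {x, y}) z s := by
          rintro s ⟨hs | hs | hs, hsn⟩
          exacts [absurd hs (by simp at hsn; tauto), absurd hs (by simp at hsn; tauto), hs]
        exact hce x hxS' y hyS' hxy fun s hs t ht =>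
          hproj hs.1 ht.1 ((hreach s hs).symm.trans (hreach t ht))
      obtain ⟨p, hp, hpl, hps, hpe⟩ := hc.exists_isPath_of_mem_edges hxyc
      have hpS' : ∀ w, w ∈ p.support ↔ w ∈ S' := fun w => by rw [← hps, hcs]
      refine ⟨p, hp, hpl, hpS', fun u hu v hv huv hr => hpe _ ?_⟩
      rw [hpS'] at hu hv
      exact hce u hu v hv huv fun s hs t ht =>
        hproj hs.1 ht.1 (hr s ⟨hsub hs.1, hs.2⟩ t ⟨hsub ht.1, ht.2⟩)
    -- A vertex in a third component would produce a closed theta.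
    have hcov : ∀ w ∈ S, w = x ∨ w = y ∨ G.ReachableIn (S \ {x, y}) z w ∨
        G.ReachableIn (S \ {x, y}) t w := by
      intro w hw
      by_contra! hne
      refine hno (hS.hasThreePathOrWheelIn hx hy hxy ![z, t, w] ?_ ?_)
      · intro i
        fin_cases i
        exacts [hz, ht, ⟨hw, by simp [hne.1, hne.2.1]⟩]
      · intro i j hij
        fin_cases i <;> fin_cases j
        exacts [absurd rfl hij, hzt, hne.2.2.1, fun h => hzt h.symm, absurd rfl hij, hne.2.2.2,
          fun h => hne.2.2.1 h.symm, fun h => hne.2.2.2 h.symm, absurd rfl hij]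
    obtain ⟨p, hp, hpl, hps, hpe⟩ := side z hz t ht hzt
    obtain ⟨q, hq, -, hqs, hqe⟩ := side t ht z hz fun h => hzt h.symm
    have hs : ∀ w, w ∈ (p.append q.reverse).support ↔ w ∈ p.support ∨ w ∈ q.support := by
      intro w
      rw [Walk.mem_support_append_iff, Walk.support_reverse, List.mem_reverse]
    refine ⟨x, p.append q.reverse, hp.isCycle_append_reverse hq ?_ (.inl hpl), fun w => ?_, ?_⟩
    · intro w hwp hwq
      rcases (hps w).1 hwp with h | h | h
      · exact .inl h
      · exact .inr h
      · rcases (hqs w).1 hwq with h' | h' | h'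
        exacts [.inl h', .inr h', absurd (h.trans h'.symm) hzt]
    · rw [hs, hps, hqs]
      constructor
      · rintro ((rfl | rfl | h) | (rfl | rfl | h))
        exacts [hx, hy, h.right_mem.1, hx, hy, h.right_mem.1]
      · intro hw
        rcases hcov w hw with h | h | h | h
        exacts [.inl (.inl h), .inl (.inr (.inl h)), .inl (.inr (.inr h)), .inr (.inr (.inr h))]
    · intro u hu v hv huv hr
      -- The edge `xy` is lost in the gluing, but its ends separate `S`, so it is not required. Any
      -- other edge lies within one of the two sides.
      have hne : s(u, v) ≠ s(x, y) := by
        intro h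
        have huvxy : ({u, v} : Set V) = {x, y} := by
          rcases Sym2.eq_iff.1 h with ⟨rfl, rfl⟩ | ⟨rfl, rfl⟩
          exacts [rfl, Set.pair_comm _ _]
        rw [huvxy] at hr
        exact hzt (hr z hz t ht)
      rw [Walk.edges_append, List.mem_append, Walk.edges_reverse, List.mem_reverse]
      have inp : u ∈ p.support → v ∈ p.support → s(u, v) ∈ p.edges ∨ s(u, v) ∈ q.edges :=
        fun h1 h2 => .inl ((hpe u h1 v h2 huv hr).resolve_left hne)
      have inq : u ∈ q.support → v ∈ q.support → s(u, v) ∈ p.edges ∨ s(u, v) ∈ q.edges :=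
        fun h1 h2 => .inr ((hqe u h1 v h2 huv hr).resolve_left hne)
      rw [hps, hps] at inp
      rw [hqs, hqs] at inq
      have adj : ∀ z, G.ReachableIn (S \ {x, y}) z u → v ∈ S \ {x, y} →
          G.ReachableIn (S \ {x, y}) z v := fun z h hv =>
        h.trans (.of_adj h.right_mem hv huv)
      have hvS : v = x ∨ v = y ∨ v ∈ S \ {x, y} := by
        by_cases h1 : v = x
        · exact .inl h1
        by_cases h2 : v = y
        · exact .inr (.inl h2)
        exact .inr (.inr ⟨hv, by simp [h1, h2]⟩)
      rcases hcov u hu with h | h | h | h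
      · rcases hcov v hv with h' | h' | h' | h'
        exacts [inp (.inl h) (.inl h'), inp (.inl h) (.inr (.inl h')),
          inp (.inl h) (.inr (.inr h')), inq (.inl h) (.inr (.inr h'))]
      · rcases hcov v hv with h' | h' | h' | h'
        exacts [inp (.inr (.inl h)) (.inl h'), inp (.inr (.inl h)) (.inr (.inl h')),
          inp (.inr (.inl h)) (.inr (.inr h')), inq (.inr (.inl h)) (.inr (.inr h'))]
      · exact inp (.inr (.inr h)) (hvS.imp_right fun h' => h'.imp_right (adj z h))
      · exact inq (.inr (.inr h)) (hvS.imp_right fun h' => h'.imp_right (adj t h))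

/-! ### Triangle-freeness of thetas, translation of the definitions, and the theorem -/

theorem ThreePathOn.cliqueFree {P : Fin 3 → G.Walk u v} (h : G.ThreePathOn Set.univ P)
    (huv : ¬ G.Adj u v) : G.CliqueFree 3 := by
  classical
  have hch : ∀ i, (P i).IsChordless := by
    refine fun i => Walk.isChordless_iff_forall_mem_edges.2 fun s t hs ht hst => ?_
    by_cases hs' : s ≠ u ∧ s ≠ v
    · exact h.mem_edges hs hs'.1 hs'.2 trivial hst
    by_cases ht' : t ≠ u ∧ t ≠ v
    · rw [Sym2.eq_swap]
      exact h.mem_edges ht ht'.1 ht'.2 trivial hst.symm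
    have hs'' : s = u ∨ s = v := by tauto
    have ht'' : t = u ∨ t = v := by tauto
    rcases hs'' with rfl | rfl <;> rcases ht'' with rfl | rfl
    exacts [absurd rfl hst.ne, absurd hst huv, absurd hst.symm huv, absurd rfl hst.ne]
  -- A triangle through an interior vertex lies on one induced path, and three positions cannot
  -- pairwise differ by one. Every triangle contains a vertex other than `u` and `v`.
  have key : ∀ x y z, G.Adj x y → G.Adj x z → G.Adj y z → x ≠ u → x ≠ v → False := by
    intro x y z hxy hxz hyz hxu hxv
    obtain ⟨i, hi⟩ := (h.mem_iff x).1 trivial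
    have hy := (P i).snd_mem_support_of_mem_edges (h.mem_edges hi hxu hxv trivial hxy)
    have hz := (P i).snd_mem_support_of_mem_edges (h.mem_edges hi hxu hxv trivial hxz)
    obtain ⟨j, rfl, hj⟩ := Walk.mem_support_iff_exists_getVert.1 hi
    obtain ⟨k, rfl, hk⟩ := Walk.mem_support_iff_exists_getVert.1 hy
    obtain ⟨l, rfl, hl⟩ := Walk.mem_support_iff_exists_getVert.1 hz
    have h1 := (h.isPath i).adj_getVert_iff (hch i) hj hk hxy
    have h2 := (h.isPath i).adj_getVert_iff (hch i) hj hl hxz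
    have h3 := (h.isPath i).adj_getVert_iff (hch i) hk hl hyz
    omega
  intro s hs
  obtain ⟨x, y, z, hxy, hxz, hyz, -⟩ := is3Clique_iff.1 hs
  by_cases hx : x ≠ u ∧ x ≠ v
  · exact key x y z hxy hxz hyz hx.1 hx.2
  by_cases hy : y ≠ u ∧ y ≠ v
  · exact key y x z hxy.symm hyz hxz hy.1 hy.2
  by_cases hz : z ≠ u ∧ z ≠ v
  · exact key z x y hxz.symm hyz.symm hxy hz.1 hz.2
  have hx' : x = u ∨ x = v := by tauto
  have hy' : y = u ∨ y = v := by tauto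
  have hz' : z = u ∨ z = v := by tauto
  rcases hx' with rfl | rfl <;> rcases hy' with rfl | rfl <;> rcases hz' with rfl | rfl <;>
    first
      | exact hxy.ne rfl
      | exact hxz.ne rfl
      | exact hyz.ne rfl

theorem ThreePathOn.isHCObstruction [Finite V] {P : Fin 3 → G.Walk u v}
    (h : G.ThreePathOn Set.univ P) : G.IsHCObstruction :=
  isHCObstruction_iff.2 ⟨h.twoConnectedOn, h.not_hamiltonianOn, fun S hne hS =>
    h.hamiltonianOn_of_ssubset (Set.subset_univ S) hne hS⟩

theorem WheelOn.isHCObstruction [Finite V] {a : V} {c : G.Walk a a}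
    (h : G.WheelOn Set.univ v c) (hG : G.CliqueFree 3) : G.IsHCObstruction :=
  isHCObstruction_iff.2 ⟨h.twoConnectedOn, h.not_hamiltonianOn hG, fun S hne hS =>
    h.hamiltonianOn_of_ssubset (Set.subset_univ S) hne hS⟩

theorem IsThetaWithEnds.exists_threePathOn (h : G.IsThetaWithEnds u v) :
    ∃ P : Fin 3 → G.Walk u v, G.ThreePathOn Set.univ P := by
  obtain ⟨hne, -, P, hP, hd, hs, he⟩ := h
  exact ⟨P, hne, fun i => (hP i).1, fun i => (hP i).2, hd, fun x => by simpa using hs x,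
    fun x _ y _ hxy => .inl (he x y hxy)⟩

theorem IsClosedTheta.exists_threePathOn (h : G.IsClosedTheta) :
    ∃ (u v : V) (P : Fin 3 → G.Walk u v), G.ThreePathOn Set.univ P := by
  obtain ⟨H, u, v, ⟨hne, -, P, hP, hd, hs, he⟩, rfl⟩ := h
  have hle : H ≤ H ⊔ edge u v := le_sup_left
  refine ⟨u, v, fun i => (P i).mapLe hle, hne, fun i => (hP i).1.mapLe hle,
    fun i => by simpa using (hP i).2, fun i j hij x => ?_, fun x => ?_, fun x _ y _ hxy => ?_⟩
  · simpa using hd i j hij x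
  · simpa using hs x
  · simp only [Walk.edges_mapLe_eq_edges]
    rcases hxy with hxy | hxy
    · exact .inl (he x y hxy)
    · exact .inr (Sym2.eq_iff.2 ((edge_adj _ _ _ _).1 hxy).1)

theorem ThreePathOn.isTheta_or_isClosedTheta {P : Fin 3 → G.Walk u v}
    (h : G.ThreePathOn Set.univ P) : G.IsTheta ∨ G.IsClosedTheta := by
  by_cases huv : G.Adj u v
  -- A path of length at least two from `u` to `v` does not use the edge `uv`, so all three paths
  -- survive its deletion.
  · have hPe : ∀ i, ∀ e ∈ (P i).edges, e ∉ ({s(u, v)} : Set (Sym2 V)) := by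
      rintro i e he rfl
      have := (h.isPath i).length_eq_one_of_mem_edges he
      have := h.two_le i
      omega
    refine .inr ⟨G.deleteEdges {s(u, v)}, u, v, ⟨h.ne, by simp [deleteEdges_adj],
      fun i => (P i).toDeleteEdges _ (hPe i), fun i => ⟨?_, ?_⟩, ?_, ?_, ?_⟩, ?_⟩
    · exact (h.isPath i).toDeleteEdges G _ (hPe i)
    · simpa using h.two_le i
    · simpa using h.disj
    · simpa using fun x => (h.mem_iff x).1 trivial
    · intro x y hxy
      rw [deleteEdges_adj] at hxy
      simpa using (h.edge x trivial y trivial hxy.1).resolve_right hxy.2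
    · ext x y
      rw [sup_adj, deleteEdges_adj, edge_adj, Set.mem_singleton_iff]
      constructor
      · intro hxy
        by_cases he : s(x, y) = s(u, v)
        exacts [.inr ⟨Sym2.eq_iff.1 he, hxy.ne⟩, .inl ⟨hxy, he⟩]
      · rintro (hxy | ⟨he, -⟩)
        · exact hxy.1
        · rwa [← mem_edgeSet, Sym2.eq_iff.2 he]
  · refine .inl ⟨u, v, h.ne, huv, P, fun i => ⟨h.isPath i, h.two_le i⟩, h.disj,
      fun x => (h.mem_iff x).1 trivial, fun x y hxy => ?_⟩
    refine (h.edge x trivial y trivial hxy).resolve_right fun he => huv ?_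
    rwa [← mem_edgeSet, ← he]

theorem isWheel_iff : G.IsWheel ↔ ∃ (v a : V) (c : G.Walk a a), G.WheelOn Set.univ v c := by
  constructor
  · rintro ⟨v, a, c, hc, hv, hs, he, h3⟩
    refine ⟨v, a, c, hc, Walk.isChordless_iff_forall_mem_edges.2 fun x y hx hy hxy =>
      he x y ?_ ?_ hxy, hv, fun x => ⟨fun _ => or_iff_not_imp_left.2 (hs x), fun _ => trivial⟩, h3⟩
    · rintro rfl
      exact hv hx
    · rintro rfl
      exact hv hy
  · rintro ⟨v, a, c, h⟩
    have hs : ∀ x, x ≠ v → x ∈ c.support := fun x => ((h.mem_iff x).1 trivial).resolve_left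
    exact ⟨v, a, c, h.isCycle, h.notMem, hs, fun x y hx hy hxy =>
      h.isChordless.mem_edges (hs x hx) (hs y hy) hxy, h.three_le⟩

/-- Minimality of obstructions, in the form that makes an induced theta, closed theta or wheel the
whole graph. -/
theorem IsHCObstruction.eq_univ (h : G.IsHCObstruction) (hS : G.TwoConnectedOn S)
    (hS' : ¬ G.HamiltonianOn S) : S = Set.univ := by
  by_contra hne
  exact hS' ((isHCObstruction_iff.1 h).2.2 S hne hS)

end SimpleGraph

theorem theorem1p3 {V : Type*} [Finite V] (G : SimpleGraph V) :
    (G.IsTheta → G.IsHCObstruction) ∧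
    (G.IsClosedTheta → G.CliqueFree 3 → G.IsHCObstruction) ∧
    (G.IsWheel → G.CliqueFree 3 → G.IsHCObstruction) ∧
    (G.IsHCObstruction ∧ G.CliqueFree 3 ↔
      G.IsTheta ∨ (G.IsClosedTheta ∧ G.CliqueFree 3) ∨ (G.IsWheel ∧ G.CliqueFree 3)) := by
  have theta : G.IsTheta → G.IsHCObstruction := by
    rintro ⟨u, v, h⟩
    obtain ⟨P, hP⟩ := h.exists_threePathOn
    exact hP.isHCObstruction
  have closed : G.IsClosedTheta → G.CliqueFree 3 → G.IsHCObstruction := by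
    intro h _
    obtain ⟨u, v, P, hP⟩ := h.exists_threePathOn
    exact hP.isHCObstruction
  have wheel : G.IsWheel → G.CliqueFree 3 → G.IsHCObstruction := by
    intro h hG
    obtain ⟨v, a, c, hc⟩ := SimpleGraph.isWheel_iff.1 h
    exact hc.isHCObstruction hG
  refine ⟨theta, closed, wheel, ?_, ?_⟩
  · rintro ⟨h, hG⟩
    obtain ⟨htc, hnh, -⟩ := SimpleGraph.isHCObstruction_iff.1 h
    by_cases hno : G.HasThreePathOrWheelIn Set.univ
    · obtain ⟨T, -, ⟨u, v, P, hP⟩ | ⟨v, a, c, hc⟩⟩ := hno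
      · obtain rfl := h.eq_univ hP.twoConnectedOn hP.not_hamiltonianOn
        exact hP.isTheta_or_isClosedTheta.imp_right fun h => .inl ⟨h, hG⟩
      · obtain rfl := h.eq_univ hc.twoConnectedOn (hc.not_hamiltonianOn hG)
        exact .inr (.inr ⟨SimpleGraph.isWheel_iff.2 ⟨v, a, c, hc⟩, hG⟩)
    · obtain ⟨a, c, hc, hs, -⟩ := htc.exists_cycle hG hno
      exact absurd ⟨a, c, hc, hs⟩ hnh
  · rintro (h | ⟨h, hG⟩ | ⟨h, hG⟩)
    · refine ⟨theta h, ?_⟩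
      obtain ⟨u, v, h⟩ := h
      obtain ⟨P, hP⟩ := h.exists_threePathOn
      exact hP.cliqueFree h.2.1
    · exact ⟨closed h hG, hG⟩
    · exact ⟨wheel h hG, hG⟩
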